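/- Let $k,m\ge 0$ be integers ($m=n-k$), let $\eta,\varepsilon>0$, $q\in[1,\infty]$, $\alpha\in[0,1)$ and $0\le s<\frac{q}{2q-1}$ (read as $s<\frac12$ if $q=\infty$) be such that $$\alpha<1-\Big(2-\frac1q\Big)s ,\qquad \tfrac1\infty:=0 .$$ Let $\Omega\subseteq\mathbb{R}^k$ be open and bounded, and let $F:\Omega\times\mathbb{R}^{m}\to \mathrm{Lin}(\mathbb{R}^k,\mathbb{R}^m)$ be locally Lipschitz. Then there are a compact set $\mathfrak C\subseteq\Omega$ and a function $u:\Omega\to\mathbb{R}^m$, with distributional gradient $Du\in L^1_{\mathrm{loc}}(\Omega)$, such that (i) $u$ has compact support contained in $\Omega$, $\|u\|_\infty\le\eta$, and $Du(x)=F(x,u(x))$ for $\mathscr L^k$-almost every $x\in\mathfrak C$; (ii) $\mathscr L^k(\Omega\setminus\mathfrak C)\le\varepsilon\,\mathscr L^k(\Omega)$ and $\mathbb 1_{\mathfrak C}\in W^{s,1}(\Omega)$; (iii) $u\in L^\infty(\Omega)\cap W^{1,q}(\Omega)$ and $Du\in W^{\alpha,q}(\Omega)$. In addition, if $0\le s<1/2$,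 then $u$ is also of class $C^1_c(\Omega)$ and $Du(x)=F(x,u(x))$ holds for every $x\in\mathfrak C$. Finally, if $s=0$, then $u\in\bigcap_{0<\beta<1}C^{1,\beta}(\Omega)$. Here, for $0<\sigma<1$ and $1\le p<\infty$, $W^{\sigma,p}(\Omega)$ is the space of $v\in L^p(\Omega)$ with $$\int_\Omega\int_\Omega\frac{|v(x)-v(y)|^p}{|x-y|^{\sigma p+k}}\,dx\,dy<\infty ,$$ $W^{\sigma,\infty}(\Omega)$ is the space of (functions almost everywhere equal to) bounded $\sigma$-Hölder functions on $\Omega$, and $W^{0,p}(\Omega)=L^p(\Omega)$. The space $C^{1,\beta}(\Omega)$ consists of the $C^1$ functions on $\Omega$ that are bounded, with bounded and $\beta$-Hölder gradient. -/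

import Mathlib

open MeasureTheory Set
open scoped ENNReal NNReal

noncomputable section

/-- The Euclidean space `ℝᵏ` with its Euclidean norm. -/
abbrev Euc (k : ℕ) : Type := EuclideanSpace ℝ (Fin k)

/-- `g` is the distributional gradient of `u` on the open set `Ω`: both are locally integrable
on `Ω`, and the integration by parts formula holds, in every direction `v`, against every
real-valued smooth test function with compact support in `Ω`. -/
def IsWeakGradient {k m : ℕ} (Ω : Set (Euc k)) (u : Euc k → Euc m)
    (g : Euc k → (Euc k →L[ℝ] Euc m)) : Prop :=
  LocallyIntegrableOn u Ω volume ∧ LocallyIntegrableOn g Ω volume ∧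
    ∀ φ : Euc k → ℝ, ContDiff ℝ ((⊤ : ℕ∞) : WithTop ℕ∞) φ → HasCompactSupport φ → tsupport φ ⊆ Ω →
      ∀ v : Euc k, ∫ x in Ω, (fderiv ℝ φ x v) • u x = -∫ x in Ω, φ x • g x v

/-- The `p`-th power of the Gagliardo seminorm of `v` on `Ω`, for finite `p`:
`∫_Ω ∫_Ω |v x - v y| ^ p / |x - y| ^ (s p + k) dx dy`. -/
def gagliardoEnergy {k : ℕ} {G : Type*} [NormedAddCommGroup G]
    (s p : ℝ) (Ω : Set (Euc k)) (v : Euc k → G) : ℝ≥0∞ :=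
  ∫⁻ x in Ω, ∫⁻ y in Ω, ‖v x - v y‖ₑ ^ p / ‖x - y‖ₑ ^ (s * p + k)

/-- Membership in `W^{s,p}(Ω)`, for `0 ≤ s < 1` and `1 ≤ p ≤ ∞`. As usual `W^{0,p} = L^p`; for
`0 < s` and `p = ∞` the space consists of the functions in `L^∞` that agree almost everywhere
with an `s`-Hölder function on `Ω`. -/
def MemFracSobolev {k : ℕ} {G : Type*} [NormedAddCommGroup G]
    (s : ℝ) (p : ℝ≥0∞) (Ω : Set (Euc k)) (v : Euc k → G) : Prop :=
  MemLp v p (volume.restrict Ω) ∧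
    (0 < s → p ≠ ∞ → gagliardoEnergy s p.toReal Ω v < ∞) ∧
    (0 < s → p = ∞ → ∃ w : Euc k → G, w =ᵐ[volume.restrict Ω] v ∧
      ∃ C : ℝ≥0, HolderOnWith C s.toNNReal w Ω)

/-- `u` belongs to `C^{1,α}(Ω)`, for `Ω` open: it is continuously differentiable on `Ω`, bounded
with bounded derivative, and its derivative is `α`-Hölder on `Ω`. -/
def MemC1Holder {k m : ℕ} (α : ℝ) (Ω : Set (Euc k)) (u : Euc k → Euc m) : Prop :=
  ContDiffOn ℝ 1 u Ω ∧ (∃ M : ℝ, ∀ x ∈ Ω, ‖u x‖ ≤ M) ∧ (∃ M : ℝ, ∀ x ∈ Ω, ‖fderiv ℝ u x‖ ≤ M) ∧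
    ∃ C : ℝ≥0, HolderOnWith C α.toNNReal (fderiv ℝ u) Ω

end

/-! The function is built by successive corrections on dyadic cubic grids of mesh `r n = r₀ / 2 ^
n`. Given an approximate solution `U` with cellwise constant approximate gradient `P`, one picks in
each cell a base point `b` of the current good set and adds the affine function `A (x - b)`, where
`A = F (b, U b) - P b` is the defect at `b`. The correction is multiplied by a smooth cutoff that
vanishes near the faces of the cells and equals one at relative distance at least `δ n` from them.
On the points that avoid all these gaps the cutoffs are invisible: `U` is affine on each cell with
gradient `P`, and since `F` is Lipschitz, the new defect is at most a constant times the mesh. So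
`‖A‖ ≤ C * r n`, the series converges, and its formal derivative equals `F (x, u x)` on the set `K`
of points that avoid every gap (`exists_cell_corrections`, `exists_isCorrectionSeries`).

Regularity is a competition between the mesh and the gap width. The derivative of the `n`-th
correction is of order `r / δ` with Lipschitz constant of order `1 / δ ^ 2`; by interpolation its
`θ`-Hölder constant is of order `r ^ (1 - θ) * δ ^ (-(1 + θ))`. Between points off the gaps it is
only `r ^ (1 - θ) * δ ^ (-θ)`. The gaps have volume of order `δ`, which gains a factor `δ ^ (1 / q)`
in the norms of exponent `q`. With `δ n = c * 2 ^ (-τ n) / (n + 1) ^ 2` the series of derivatives is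
therefore controlled when `τ * (1 + θ - 1 / q) < 1 - θ` (`exists_decay`,
`gagliardoEnergy_tsum_lt_top`).

The perimeter pulls the other way: slicing each gap into dyadic layers bounds the energy of order
below `θ'` of the indicator of `K` by the sum of `δ ^ (1 - θ') * r ^ (-θ')`, finite if `θ' < τ * (1
- θ')` (`gagliardoEnergy_indicator_lt_top`). With `τ` slightly above `s / (1 - s)` both conditions
hold exactly because `α < 1 - (2 - 1 / q) * s` (`exists_exponents`). If `s < 1 / 2` one can take `τ
< 1`, so that `r / δ` is summable and `u` is `C¹`; if `s = 0` one takes `τ = 0` and every Hölder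
exponent below one is allowed. The factor `(n + 1) ^ (-2)` keeps the gap volumes summable even then,
and `c` makes their total small. -/

/-! ### Riesz kernels and a criterion for finite Gagliardo energy -/

/-- The Riesz kernel of positive order has a finite integral over a ball about the origin. -/
theorem lintegral_ball_enorm_rpow_lt_top {k : ℕ} {σ : ℝ} (hσ : 0 < σ) (R : ℝ) :
    ∫⁻ z in Metric.ball (0 : Euc k) R, ‖z‖ₑ ^ (σ - k) < ∞ := by
  rcases Nat.eq_zero_or_pos k with rfl | hk
  -- In dimension zero the only point is the origin, where the kernel is `0 ^ σ = 0`; the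
  -- polar-coordinate criterion below needs positive dimension.
  · have : ∀ z : Euc 0, ‖z‖ₑ ^ (σ - (0 : ℕ)) = 0 := fun z => by
      rw [Subsingleton.elim z 0]; simp [hσ]
    simp_rw [this]
    simp
  · have hfin : Module.finrank ℝ (Euc k) = k := by simp
    have hm : AEStronglyMeasurable (fun z : Euc k => ‖z‖ ^ (σ - k)) volume :=
      (measurable_norm.pow_const _).aestronglyMeasurable
    have h1 : IntegrableOn (fun z : Euc k => ‖z‖ ^ (σ - k)) (Metric.ball 0 R) volume := by
      refine integrableOn_ball_of_norm_le_rpow (C := 1) (α := k - σ) (by rw [hfin]; exact hk)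
        (by rw [hfin]; linarith) ?_ hm
      refine Filter.Eventually.of_forall fun z => ?_
      rw [Real.norm_of_nonneg (by positivity), one_mul, neg_sub]
    have h2 := h1.2
    rw [HasFiniteIntegral] at h2
    refine lt_of_le_of_lt (le_of_eq ?_) h2
    have hne : Nontrivial (Euc k) := Module.nontrivial_of_finrank_pos (R := ℝ) (by rw [hfin]; exact hk)
    refine lintegral_congr_ae (ae_restrict_of_ae ?_)
    have h0 : ∀ᵐ z : Euc k ∂volume, z ≠ 0 := by
      rw [ae_iff]; simp
    filter_upwards [h0] with z hz
    have hz' : 0 < ‖z‖ := norm_pos_iff.2 hz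
    rw [Real.enorm_eq_ofReal (by positivity), ← ENNReal.ofReal_rpow_of_pos hz', ofReal_norm]

theorem exists_lintegral_enorm_sub_rpow_le {k : ℕ} {σ : ℝ} (hσ : 0 < σ) {Ω : Set (Euc k)}
    (hΩ : Bornology.IsBounded Ω) :
    ∃ C : ℝ≥0∞, C < ∞ ∧ ∀ x ∈ Ω, ∫⁻ y in Ω, ‖x - y‖ₑ ^ (σ - k) ≤ C := by
  obtain ⟨R, hR⟩ := hΩ.subset_ball 0
  refine ⟨_, lintegral_ball_enorm_rpow_lt_top (k := k) hσ (R + R), fun x hx => ?_⟩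
  have hmp := Measure.measurePreserving_sub_left (volume : Measure (Euc k)) x
  have h1 := hmp.setLIntegral_comp_preimage (s := Metric.ball 0 (R + R)) Metric.isOpen_ball.measurableSet
    (f := fun z => ‖z‖ₑ ^ (σ - k)) (by fun_prop)
  rw [← h1]
  refine lintegral_mono_set fun y hy => ?_
  have := mem_ball_zero_iff.1 (hR hx)
  have := mem_ball_zero_iff.1 (hR hy)
  simp only [mem_preimage, mem_ball_zero_iff]
  exact (norm_sub_le _ _).trans_lt (by linarith)

theorem enorm_rpow_div_le {k : ℕ} {G : Type*} [NormedAddCommGroup G] {θ s p : ℝ}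
    (hp : 0 < p) {v : Euc k → G} {x y : Euc k} {h : ℝ≥0∞}
    (hv : ‖v x - v y‖ₑ ^ p ≤ h * ‖x - y‖ₑ ^ (θ * p)) :
    ‖v x - v y‖ₑ ^ p / ‖x - y‖ₑ ^ (s * p + k) ≤ h * ‖x - y‖ₑ ^ ((θ - s) * p - k) := by
  by_cases hxy : x = y
  · subst hxy; simp [hp]
  · have h0 : ‖x - y‖ₑ ≠ 0 := by simpa [sub_eq_zero] using hxy
    have ht : ‖x - y‖ₑ ≠ ∞ := enorm_ne_top
    rw [show (θ - s) * p - k = θ * p - (s * p + k) by ring, ENNReal.rpow_sub _ _ h0 ht]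
    rw [← mul_div_assoc]
    gcongr

/-- For the indicator at `x` the inner integral of the kernel is at most `C`. The indicator at `y`
reduces to that case by Tonelli and the symmetry of `w`. -/
theorem setLIntegral_indicator_mul_kernel_le {X : Type*} [MeasurableSpace X] {μ : Measure X}
    [SFinite μ] {Ω B : Set X} (hΩ : MeasurableSet Ω) (hB : MeasurableSet B) {w : X → X → ℝ≥0∞}
    (hwm : Measurable (Function.uncurry w)) (hws : ∀ x y, w x y = w y x) {C : ℝ≥0∞}
    (hC : ∀ x ∈ Ω, ∫⁻ y in Ω, w x y ∂μ ≤ C) :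
    ∫⁻ x in Ω, ∫⁻ y in Ω, (B.indicator 1 x + B.indicator 1 y) * w x y ∂μ ∂μ ≤
      2 * C * μ (B ∩ Ω) := by
  have hwx : ∀ x, Measurable (w x) := fun x => hwm.comp measurable_prodMk_left
  have hBi : Measurable (B.indicator (1 : X → ℝ≥0∞)) := measurable_one.indicator hB
  have h1 : ∫⁻ x in Ω, ∫⁻ y in Ω, B.indicator 1 x * w x y ∂μ ∂μ ≤ C * μ (B ∩ Ω) := by
    calc ∫⁻ x in Ω, ∫⁻ y in Ω, B.indicator 1 x * w x y ∂μ ∂μ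
        = ∫⁻ x in Ω, B.indicator 1 x * ∫⁻ y in Ω, w x y ∂μ ∂μ :=
          lintegral_congr fun x => lintegral_const_mul _ (hwx x)
      _ ≤ ∫⁻ x in Ω, B.indicator 1 x * C ∂μ :=
          setLIntegral_mono' hΩ fun x hx => by gcongr; exact hC x hx
      _ = C * μ (B ∩ Ω) := by
          rw [lintegral_mul_const _ hBi, lintegral_indicator_one hB, Measure.restrict_apply hB,
            mul_comm]
  have h2 : ∫⁻ x in Ω, ∫⁻ y in Ω, B.indicator 1 y * w x y ∂μ ∂μ ≤ C * μ (B ∩ Ω) := by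
    rw [lintegral_lintegral_swap]
    · refine le_trans (le_of_eq ?_) h1
      exact lintegral_congr fun x => lintegral_congr fun y => by rw [hws]
    · exact ((hBi.comp measurable_snd).mul hwm).aemeasurable
  have e : ∀ x, ∫⁻ y in Ω, (B.indicator 1 x + B.indicator 1 y) * w x y ∂μ =
      (∫⁻ y in Ω, B.indicator 1 x * w x y ∂μ) + ∫⁻ y in Ω, B.indicator 1 y * w x y ∂μ := by
    intro x
    simp_rw [add_mul]
    exact lintegral_add_left ((hwx x).const_mul _) _
  simp_rw [e]
  rw [lintegral_add_left]
  · calc _ ≤ C * μ (B ∩ Ω) + C * μ (B ∩ Ω) := add_le_add h1 h2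
      _ = _ := by ring
  · exact Measurable.lintegral_prod_right' (f := fun z : X × X => B.indicator 1 z.1 * w z.1 z.2)
      ((hBi.comp measurable_fst).mul hwm)

theorem setLIntegral_tsum_indicator_mul_kernel_lt_top {X : Type*} [MeasurableSpace X]
    {μ : Measure X} [SFinite μ] {Ω : Set X} (hΩ : MeasurableSet Ω) (hvol : μ Ω < ∞)
    {w : X → X → ℝ≥0∞}
    (hwm : Measurable (Function.uncurry w)) (hws : ∀ x y, w x y = w y x) {C : ℝ≥0∞} (hCt : C < ∞)
    (hC : ∀ x ∈ Ω, ∫⁻ y in Ω, w x y ∂μ ≤ C) {ι : Type*} [Countable ι] {A : ι → Set X}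
    (hA : ∀ i, MeasurableSet (A i)) {h0 : ℝ≥0∞} {h : ι → ℝ≥0∞} (hh0 : h0 < ∞)
    (hh : ∑' i, h i * μ (A i ∩ Ω) < ∞) :
    ∫⁻ x in Ω, ∫⁻ y in Ω, (h0 + ∑' i, h i * ((A i).indicator 1 x + (A i).indicator 1 y)) * w x y
      ∂μ ∂μ < ∞ := by
  have hwx : ∀ x, Measurable (w x) := fun x => hwm.comp measurable_prodMk_left
  have hind : ∀ i, Measurable ((A i).indicator (1 : X → ℝ≥0∞)) := fun i =>
    measurable_one.indicator (hA i)
  have hi : ∀ i, Measurable (fun z : X × X =>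
      ((A i).indicator 1 z.1 + (A i).indicator 1 z.2) * w z.1 z.2) := fun i =>
    (((hind i).comp measurable_fst).add ((hind i).comp measurable_snd)).mul hwm
  have hix : ∀ i x, Measurable (fun y : X =>
      ((A i).indicator 1 x + (A i).indicator 1 y) * w x y) := fun i x =>
    (measurable_const.add (hind i)).mul (hwx x)
  have e : ∀ x, ∫⁻ y in Ω, (h0 + ∑' i, h i * ((A i).indicator 1 x + (A i).indicator 1 y)) * w x y
      ∂μ = (∫⁻ y in Ω, h0 * w x y ∂μ) + ∑' i, h i * ∫⁻ y in Ω,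
        ((A i).indicator 1 x + (A i).indicator 1 y) * w x y ∂μ := by
    intro x
    simp_rw [add_mul, ← ENNReal.tsum_mul_right, ← add_mul, mul_assoc]
    rw [lintegral_add_left ((hwx x).const_mul _), lintegral_tsum]
    · congr 1
      exact tsum_congr fun i => lintegral_const_mul _ (hix i x)
    · exact fun i => ((hix i x).const_mul _).aemeasurable
  simp_rw [e]
  rw [lintegral_add_left, lintegral_tsum]
  · refine ENNReal.add_lt_top.2 ⟨?_, ?_⟩
    · calc ∫⁻ x in Ω, ∫⁻ y in Ω, h0 * w x y ∂μ ∂μ ≤ ∫⁻ x in Ω, h0 * C ∂μ := by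
            refine setLIntegral_mono' hΩ fun x hx => ?_
            rw [lintegral_const_mul _ (hwx x)]
            gcongr; exact hC x hx
        _ = h0 * C * μ Ω := by rw [setLIntegral_const]
        _ < ∞ := ENNReal.mul_lt_top (ENNReal.mul_lt_top hh0 hCt) hvol
    · calc _ ≤ ∑' i, 2 * C * (h i * μ (A i ∩ Ω)) := by
            refine ENNReal.tsum_le_tsum fun i => ?_
            rw [lintegral_const_mul _ (hi i).lintegral_prod_right']
            calc _ ≤ h i * (2 * C * μ (A i ∩ Ω)) := by
                  gcongr; exact setLIntegral_indicator_mul_kernel_le hΩ (hA i) hwm hws hC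
              _ = _ := by ring
        _ < ∞ := by
            rw [ENNReal.tsum_mul_left]
            exact ENNReal.mul_lt_top (ENNReal.mul_lt_top (by simp) hCt) hh
  · exact fun i => ((hi i).lintegral_prod_right'.const_mul _).aemeasurable
  · exact (hwm.const_mul h0).lintegral_prod_right'

/-- A countable family of Hölder bounds, each for the pairs of points that meet a set `A i`,
bounds the Gagliardo energy of lower order. -/
theorem gagliardoEnergy_lt_top_of_le {k : ℕ} {G : Type*} [NormedAddCommGroup G] {θ s p : ℝ}
    (hp : 0 < p) (hsθ : s < θ) {Ω : Set (Euc k)} (hΩ : MeasurableSet Ω)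
    (hΩb : Bornology.IsBounded Ω) {ι : Type*} [Countable ι] {A : ι → Set (Euc k)}
    (hA : ∀ i, MeasurableSet (A i)) {h0 : ℝ≥0∞} {h : ι → ℝ≥0∞} (hh0 : h0 < ∞)
    (hh : ∑' i, h i * volume (A i ∩ Ω) < ∞) {v : Euc k → G}
    (hv : ∀ᵐ x ∂(volume.restrict Ω), ∀ᵐ y ∂(volume.restrict Ω), ‖v x - v y‖ₑ ^ p ≤
      (h0 + ∑' i, h i * ((A i).indicator 1 x + (A i).indicator 1 y)) * ‖x - y‖ₑ ^ (θ * p)) :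
    gagliardoEnergy s p Ω v < ∞ := by
  have hσ : 0 < (θ - s) * p := mul_pos (sub_pos.2 hsθ) hp
  obtain ⟨C, hC, hCle⟩ := exists_lintegral_enorm_sub_rpow_le (k := k) hσ hΩb
  refine lt_of_le_of_lt ?_ (setLIntegral_tsum_indicator_mul_kernel_lt_top (μ := volume)
    (w := fun x y : Euc k => ‖x - y‖ₑ ^ ((θ - s) * p - k)) hΩ hΩb.measure_lt_top
    (by simp only [Function.uncurry_def]; fun_prop) (fun x y => by simp only [enorm_sub_rev])
    hC hCle hA hh0 hh)
  refine lintegral_mono_ae ?_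
  filter_upwards [hv] with x hx
  refine lintegral_mono_ae ?_
  filter_upwards [hx] with y hy
  exact enorm_rpow_div_le hp hy

/-! ### Distance to the nearest integer and the volume of grid slabs -/

/-- The distance from a real number to the nearest integer. -/
noncomputable def distInt (t : ℝ) : ℝ := |t - round t|

theorem distInt_nonneg (t : ℝ) : 0 ≤ distInt t := abs_nonneg _

theorem distInt_le_abs_sub (t : ℝ) (z : ℤ) : distInt t ≤ |t - z| := round_le t z

theorem distInt_le_half (t : ℝ) : distInt t ≤ 1 / 2 := abs_sub_round t

theorem distInt_sub_distInt_le (s t : ℝ) : distInt s - distInt t ≤ |s - t| := by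
  have h1 := distInt_le_abs_sub s (round t)
  have h2 := abs_sub_le s t (round t)
  have h3 : distInt t = |t - round t| := rfl
  linarith

theorem continuous_distInt : Continuous distInt := by
  have : LipschitzWith 1 distInt := LipschitzWith.of_le_add fun s t => by
    have := distInt_sub_distInt_le s t
    rw [Real.dist_eq]; linarith
  exact this.continuous

theorem exists_int_mem_Icc_of_floor_lt {s t : ℝ} (h : ⌊s⌋ < ⌊t⌋) : ∃ z : ℤ, s ≤ z ∧ (z : ℝ) ≤ t :=
  ⟨⌊t⌋, (Int.floor_lt.1 h).le, Int.floor_le t⟩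

/-- An integer lies between `s` and `t`, and both distances can be measured to it. -/
theorem distInt_add_distInt_le_of_floor_ne {s t : ℝ} (h : ⌊s⌋ ≠ ⌊t⌋) :
    distInt s + distInt t ≤ |s - t| := by
  wlog hlt : ⌊s⌋ < ⌊t⌋ generalizing s t
  · rw [add_comm, abs_sub_comm]
    exact this h.symm (lt_of_le_of_ne (not_lt.1 hlt) h.symm)
  obtain ⟨z, hsz, hzt⟩ := exists_int_mem_Icc_of_floor_lt hlt
  have h1 := distInt_le_abs_sub s z
  have h2 := distInt_le_abs_sub t z
  rw [abs_of_nonpos (by linarith)] at h1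
  rw [abs_of_nonneg (by linarith)] at h2
  rw [abs_of_nonpos (by linarith)]
  linarith

/-- Jordan's inequality. It lets the smooth periodic function `sin (π t)` replace the nonsmooth
`distInt` in the cutoffs. -/
theorem two_mul_distInt_le_abs_sin (t : ℝ) : 2 * distInt t ≤ |Real.sin (Real.pi * t)| := by
  have h1 : |Real.sin (Real.pi * t)| = |Real.sin (Real.pi * (t - round t))| := by
    rw [mul_sub, mul_comm Real.pi (round t : ℝ), Real.sin_sub_int_mul_pi]
    rw [abs_mul, abs_zpow]; simp
  have h2 : |Real.sin (Real.pi * (t - round t))| = Real.sin (Real.pi * distInt t) := by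
    have hpi := Real.pi_pos
    have hs : 0 ≤ Real.sin (Real.pi * distInt t) := by
      apply Real.sin_nonneg_of_nonneg_of_le_pi
      · exact mul_nonneg hpi.le (distInt_nonneg t)
      · nlinarith [distInt_le_half t]
    unfold distInt at hs ⊢
    rcases abs_cases (t - round t) with h | h
    · rw [h.1] at hs ⊢; rw [abs_of_nonneg hs]
    · rw [h.1] at hs ⊢; rw [mul_neg, Real.sin_neg] at hs ⊢
      rw [abs_of_nonpos (by linarith)]
  rw [h1, h2]
  have h3 := Real.mul_le_sin (x := Real.pi * distInt t)
    (mul_nonneg Real.pi_pos.le (distInt_nonneg t))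
    (by nlinarith [distInt_le_half t, Real.pi_pos])
  calc 2 * distInt t = 2 / Real.pi * (Real.pi * distInt t) := by
        field_simp
    _ ≤ _ := h3

/-- About `2 R / r` integers are relevant, each contributing two intervals of length `r * (b - a)`.
The mesh cancels, so the bound is uniform in `r ≤ 1`. -/
theorem volume_Icc_inter_distInt_le {R r a b : ℝ} (hR : 0 ≤ R) (hr : 0 < r) (hr1 : r ≤ 1)
    (hab : a ≤ b) :
    volume {t : ℝ | t ∈ Icc (-R) R ∧ a ≤ distInt (t / r) ∧ distInt (t / r) < b} ≤
      ENNReal.ofReal ((4 * R + 10) * (b - a)) := by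
  set N : ℤ := ⌈R / r⌉ + 1 with hN
  have hNR : R / r + 1 ≤ N := by
    rw [hN]; push_cast; linarith [Int.le_ceil (R / r)]
  have hNR' : (N : ℝ) ≤ R / r + 2 := by
    rw [hN]; push_cast; linarith [Int.ceil_lt_add_one (R / r)]
  have hRr : 0 ≤ R / r := div_nonneg hR hr.le
  have hsub : {t : ℝ | t ∈ Icc (-R) R ∧ a ≤ distInt (t / r) ∧ distInt (t / r) < b} ⊆
      ⋃ z ∈ Finset.Icc (-N) N, (Icc (r * (z + a)) (r * (z + b)) ∪
        Icc (r * (z - b)) (r * (z - a))) := by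
    rintro t ⟨⟨ht1, ht2⟩, hta, htb⟩
    have hh := distInt_le_half (t / r)
    have htr : t = r * (t / r) := by field_simp
    have h1 : -(R / r) ≤ t / r := by rw [← neg_div]; gcongr
    have h2 : t / r ≤ R / r := by gcongr
    unfold distInt at hta htb hh
    have h3 := abs_le.1 hh
    simp only [mem_iUnion]
    refine ⟨round (t / r), ?_, ?_⟩
    · rw [Finset.mem_Icc]
      constructor
      · have : (-N : ℝ) ≤ round (t / r) := by linarith
        exact_mod_cast this
      · have : (round (t / r) : ℝ) ≤ N := by linarith
        exact_mod_cast this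
    · rcases abs_cases (t / r - round (t / r)) with h | h
      · left
        rw [h.1] at hta htb
        constructor
        · nth_rw 2 [htr]; gcongr; linarith
        · nth_rw 1 [htr]; gcongr; linarith
      · right
        rw [h.1] at hta htb
        constructor
        · nth_rw 2 [htr]; gcongr; linarith
        · nth_rw 1 [htr]; gcongr; linarith
  have hcard : ((Finset.Icc (-N) N).card : ℝ) ≤ 2 * (R / r) + 5 := by
    have hNn : 0 ≤ N := by
      have : (0 : ℝ) ≤ N := by linarith
      exact_mod_cast this
    rw [Int.card_Icc]
    have : (((N + 1 - -N).toNat : ℤ) : ℝ) = 2 * N + 1 := by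
      rw [Int.toNat_of_nonneg (by omega)]; push_cast; ring
    have h' : (((N + 1 - -N).toNat : ℕ) : ℝ) = 2 * N + 1 := by exact_mod_cast this
    rw [h']; linarith
  calc _ ≤ volume (⋃ z ∈ Finset.Icc (-N) N, (Icc (r * (z + a)) (r * (z + b)) ∪
        Icc (r * (z - b)) (r * (z - a)))) := measure_mono hsub
    _ ≤ ∑ z ∈ Finset.Icc (-N) N, volume (Icc (r * (z + a)) (r * (z + b)) ∪
        Icc (r * (z - b)) (r * (z - a))) := measure_biUnion_finset_le _ _
    _ ≤ ∑ z ∈ Finset.Icc (-N) N, ENNReal.ofReal (2 * (r * (b - a))) := by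
        refine Finset.sum_le_sum fun z _ => (measure_union_le _ _).trans ?_
        rw [Real.volume_Icc, Real.volume_Icc, two_mul, ENNReal.ofReal_add]
        · apply add_le_add <;> apply ENNReal.ofReal_le_ofReal <;> linarith
        all_goals exact mul_nonneg hr.le (by linarith)
    _ = ENNReal.ofReal ((Finset.Icc (-N) N).card * (2 * (r * (b - a)))) := by
        rw [Finset.sum_const, nsmul_eq_mul, ENNReal.ofReal_mul (p := ((Finset.Icc (-N) N).card : ℝ))
          (by positivity), ENNReal.ofReal_natCast]
    _ ≤ _ := by
        apply ENNReal.ofReal_le_ofReal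
        have hba : 0 ≤ b - a := by linarith
        calc _ ≤ (2 * (R / r) + 5) * (2 * (r * (b - a))) := by gcongr
          _ = (4 * R + 10 * r) * (b - a) := by field_simp; ring
          _ ≤ _ := by gcongr; linarith

theorem exists_volume_inter_distInt_le {k : ℕ} {Ω : Set (Euc k)} (hΩ : Bornology.IsBounded Ω) :
    ∃ C : ℝ, 0 < C ∧ ∀ r a b : ℝ, 0 < r → r ≤ 1 → a ≤ b →
      volume ({x : Euc k | ∃ i, a ≤ distInt (x i / r) ∧ distInt (x i / r) < b} ∩ Ω) ≤
        ENNReal.ofReal (C * (b - a)) := by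
  obtain ⟨R, hRpos, hR⟩ : ∃ R > 0, ∀ x ∈ Ω, ‖x‖ ≤ R := hΩ.exists_pos_norm_le
  -- The set is covered by `k` boxes, each with one side replaced by the one-dimensional slab. The
  -- final `+ 1` only keeps the constant positive when `k = 0`.
  refine ⟨k * ((4 * R + 10) * (2 * R) ^ (k - 1)) + 1, by positivity, fun r a b hr hr1 hab => ?_⟩
  have hba : 0 ≤ b - a := by linarith
  set S : Set ℝ := {t : ℝ | t ∈ Icc (-R) R ∧ a ≤ distInt (t / r) ∧ distInt (t / r) < b} with hS
  have hSm : MeasurableSet S := by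
    have hm : Measurable fun t : ℝ => distInt (t / r) :=
      continuous_distInt.measurable.comp (measurable_id.div_const r)
    exact measurableSet_Icc.inter ((measurableSet_le measurable_const hm).inter
      (measurableSet_lt hm measurable_const))
  let T : Fin k → Fin k → Set ℝ := fun i j => if j = i then S else Icc (-R) R
  have hTm : ∀ i j, MeasurableSet (T i j) := fun i j => by
    simp only [T]; split_ifs
    · exact hSm
    · exact measurableSet_Icc
  have hsub : ({x : Euc k | ∃ i, a ≤ distInt (x i / r) ∧ distInt (x i / r) < b} ∩ Ω) ⊆
      ⋃ i, (WithLp.ofLp : Euc k → (Fin k → ℝ)) ⁻¹' (Set.pi univ (T i)) := by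
    rintro x ⟨⟨i, hi⟩, hx⟩
    have hxj : ∀ j, x j ∈ Icc (-R) R := fun j =>
      abs_le.1 ((PiLp.norm_apply_le x j).trans (hR x hx))
    refine mem_iUnion.2 ⟨i, ?_⟩
    rw [mem_preimage, mem_univ_pi]
    intro j
    simp only [T]; split_ifs with h
    · subst h; exact ⟨hxj _, hi⟩
    · exact hxj j
  calc _ ≤ volume (⋃ i, (WithLp.ofLp : Euc k → (Fin k → ℝ)) ⁻¹' (Set.pi univ (T i))) :=
        measure_mono hsub
    _ ≤ ∑ i, volume ((WithLp.ofLp : Euc k → (Fin k → ℝ)) ⁻¹' (Set.pi univ (T i))) :=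
        measure_iUnion_fintype_le _ _
    _ ≤ ∑ i : Fin k, ENNReal.ofReal (((4 * R + 10) * (2 * R) ^ (k - 1)) * (b - a)) := by
        refine Finset.sum_le_sum fun i _ => ?_
        rw [(PiLp.volume_preserving_ofLp (Fin k)).measure_preimage
          (MeasurableSet.univ_pi (hTm i)).nullMeasurableSet, volume_pi, Measure.pi_pi,
          ← Finset.mul_prod_erase _ _ (Finset.mem_univ i)]
        have e1 : ∏ j ∈ Finset.univ.erase i, volume (T i j) = ENNReal.ofReal (2 * R) ^ (k - 1) := by
          rw [Finset.prod_congr rfl (g := fun _ => ENNReal.ofReal (2 * R))]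
          · simp
          · intro j hj
            simp only [T, if_neg (Finset.ne_of_mem_erase hj), Real.volume_Icc]
            congr 1; ring
        rw [e1]
        simp only [T, if_true]
        calc _ ≤ ENNReal.ofReal ((4 * R + 10) * (b - a)) * ENNReal.ofReal (2 * R) ^ (k - 1) := by
              gcongr; exact volume_Icc_inter_distInt_le hRpos.le hr hr1 hab
          _ = _ := by
              rw [← ENNReal.ofReal_pow (by positivity), ← ENNReal.ofReal_mul (by positivity)]
              congr 1; ring
    _ = ENNReal.ofReal (k * ((4 * R + 10) * (2 * R) ^ (k - 1)) * (b - a)) := by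
        rw [Finset.sum_const, nsmul_eq_mul, mul_assoc (k : ℝ), ENNReal.ofReal_mul (Nat.cast_nonneg k),
          ENNReal.ofReal_natCast]
        simp
    _ ≤ _ := by
        apply ENNReal.ofReal_le_ofReal
        gcongr; linarith

/-! ### Cutoff functions -/

/-- A function bounded by one, with derivative `φ'` bounded by `t` and `t ^ 2`-Lipschitz. -/
structure IsCutoff {E : Type*} [NormedAddCommGroup E] [NormedSpace ℝ E] (φ : E → ℝ)
    (φ' : E → E →L[ℝ] ℝ) (t : ℝ) : Prop where
  hasFDerivAt : ∀ x, HasFDerivAt φ (φ' x) x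
  abs_le_one : ∀ x, |φ x| ≤ 1
  norm_deriv_le : ∀ x, ‖φ' x‖ ≤ t
  norm_deriv_sub_le : ∀ x y, ‖φ' x - φ' y‖ ≤ t ^ 2 * ‖x - y‖

namespace IsCutoff

variable {E : Type*} [NormedAddCommGroup E] [NormedSpace ℝ E]

theorem abs_sub_le {φ : E → ℝ} {φ' : E → E →L[ℝ] ℝ} {t : ℝ} (h : IsCutoff φ φ' t) (x y : E) :
    |φ x - φ y| ≤ t * ‖x - y‖ := by
  have := Convex.norm_image_sub_le_of_norm_hasFDerivWithin_le (s := univ) (f := φ) (f' := φ')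
    (C := t) (fun x _ => (h.hasFDerivAt x).hasFDerivWithinAt) (fun x _ => h.norm_deriv_le x)
    convex_univ (mem_univ y) (mem_univ x)
  simpa using this

theorem one : IsCutoff (fun _ : E => (1 : ℝ)) (fun _ => 0) 0 :=
  ⟨fun x => hasFDerivAt_const 1 x, by simp, by simp, by simp⟩

/-- The parameters add: the two cross terms in the Leibniz rule contribute `2 a b`, which completes
`a ^ 2 + b ^ 2` to `(a + b) ^ 2`. -/
theorem mul {φ ψ : E → ℝ} {φ' ψ' : E → E →L[ℝ] ℝ} {a b : ℝ} (hφ : IsCutoff φ φ' a)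
    (hψ : IsCutoff ψ ψ' b) :
    IsCutoff (fun x => φ x * ψ x) (fun x => φ x • ψ' x + ψ x • φ' x) (a + b) := by
  refine ⟨fun x => (hφ.hasFDerivAt x).mul (hψ.hasFDerivAt x), fun x => ?_, fun x => ?_,
    fun x y => ?_⟩
  · rw [abs_mul]
    exact mul_le_one₀ (hφ.abs_le_one x) (abs_nonneg _) (hψ.abs_le_one x)
  · refine (norm_add_le _ _).trans ?_
    rw [norm_smul, norm_smul, Real.norm_eq_abs, Real.norm_eq_abs, add_comm a b]
    have h1 := mul_le_mul (hφ.abs_le_one x) (hψ.norm_deriv_le x) (norm_nonneg _) zero_le_one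
    have h2 := mul_le_mul (hψ.abs_le_one x) (hφ.norm_deriv_le x) (norm_nonneg _) zero_le_one
    linarith
  · have e : φ x • ψ' x + ψ x • φ' x - (φ y • ψ' y + ψ y • φ' y) =
        (φ x • (ψ' x - ψ' y) + (φ x - φ y) • ψ' y) + (ψ x • (φ' x - φ' y) + (ψ x - ψ y) • φ' y) := by
      module
    rw [e]
    refine (norm_add_le _ _).trans ((add_le_add (norm_add_le _ _) (norm_add_le _ _)).trans ?_)
    simp only [norm_smul, Real.norm_eq_abs]
    have ha : 0 ≤ a := (norm_nonneg _).trans (hφ.norm_deriv_le x)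
    have h1 := mul_le_mul (hφ.abs_le_one x) (hψ.norm_deriv_sub_le x y) (norm_nonneg _) zero_le_one
    have h2 := mul_le_mul (hψ.abs_le_one x) (hφ.norm_deriv_sub_le x y) (norm_nonneg _) zero_le_one
    have hb : 0 ≤ b := (norm_nonneg _).trans (hψ.norm_deriv_le x)
    have h3 := mul_le_mul (hφ.abs_sub_le x y) (hψ.norm_deriv_le y) (norm_nonneg _)
      (mul_nonneg ha (norm_nonneg _))
    have h4 := mul_le_mul (hψ.abs_sub_le x y) (hφ.norm_deriv_le y) (norm_nonneg _)
      (mul_nonneg hb (norm_nonneg _))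
    nlinarith

theorem exists_prod {ι : Type*} (s : Finset ι) {φ : ι → E → ℝ} {φ' : ι → E → E →L[ℝ] ℝ} {t : ℝ}
    (h : ∀ i, IsCutoff (φ i) (φ' i) t) :
    ∃ Φ', IsCutoff (fun x => ∏ i ∈ s, φ i x) Φ' (s.card * t) := by
  classical
  induction s using Finset.induction_on with
  | empty => exact ⟨fun _ => 0, by simpa using IsCutoff.one⟩
  | insert a s ha ih =>
    obtain ⟨Φ', hΦ⟩ := ih
    refine ⟨fun x => φ a x • Φ' x + (∏ i ∈ s, φ i x) • φ' a x, ?_⟩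
    simp only [Finset.prod_insert ha, Finset.card_insert_of_notMem ha, Nat.cast_add, Nat.cast_one]
    have e : (s.card + 1 : ℝ) * t = t + s.card * t := by ring
    rw [e]
    exact (h a).mul hΦ

theorem mono {φ : E → ℝ} {φ' : E → E →L[ℝ] ℝ} {a b : ℝ} (h : IsCutoff φ φ' a) (hab : a ≤ b) :
    IsCutoff φ φ' b := by
  refine ⟨h.hasFDerivAt, h.abs_le_one, fun x => (h.norm_deriv_le x).trans hab, fun x y =>
    (h.norm_deriv_sub_le x y).trans ?_⟩
  have ha : 0 ≤ a := (norm_nonneg _).trans (h.norm_deriv_le x)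
  gcongr

end IsCutoff

/-- A smooth profile that vanishes near the origin and equals one away from it. -/
theorem exists_cutoff_profile : ∃ (χ χ' : ℝ → ℝ) (C : ℝ), 1 ≤ C ∧ (∀ s, HasDerivAt χ (χ' s) s) ∧
    (∀ s, |χ s| ≤ 1) ∧ (∀ s, |χ' s| ≤ C) ∧ (∀ s t, |χ' s - χ' t| ≤ C ^ 2 * |s - t|) ∧
    (∀ s, |s| < 1 → χ s = 0) ∧ ∀ s, 3 / 2 < |s| → χ s = 1 := by
  let b : ContDiffBump (0 : ℝ) := ⟨1, 3 / 2, by norm_num, by norm_num⟩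
  have hb : ContDiff ℝ 2 b := b.contDiff
  have hb1 : ContDiff ℝ 1 (deriv b) := ContDiff.deriv' (n := 1) (by exact_mod_cast hb)
  have hcs : HasCompactSupport b := b.hasCompactSupport
  obtain ⟨C1, hC1⟩ := hcs.deriv.exists_bound_of_continuous hb1.continuous
  obtain ⟨C2, hC2⟩ := hcs.deriv.deriv.exists_bound_of_continuous (hb1.continuous_deriv le_rfl)
  have hd : Differentiable ℝ b := hb.differentiable (by norm_num)
  have hd1 : Differentiable ℝ (deriv b) := hb1.differentiable one_ne_zero
  refine ⟨fun s => 1 - b s, fun s => - deriv b s, max 1 (max C1 C2), le_max_left _ _, fun s => ?_,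
    fun s => ?_, fun s => ?_, fun s t => ?_, fun s hs => ?_, fun s hs => ?_⟩
  · exact (hd s).hasDerivAt.const_sub 1
  · rw [abs_le]; constructor <;> linarith [b.nonneg' s, b.le_one (x := s)]
  · rw [abs_neg]
    exact (hC1 s).trans ((le_max_left _ _).trans (le_max_right _ _))
  · have h1 := Convex.norm_image_sub_le_of_norm_deriv_le (s := univ) (f := deriv b) (C := C2)
      (fun x _ => hd1 x) (fun x _ => hC2 x) convex_univ (mem_univ t) (mem_univ s)
    rw [Real.norm_eq_abs, Real.norm_eq_abs] at h1
    -- A constant at least one lets `C ^ 2` dominate the bound on the second derivative, so a single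
    -- `C` serves both orders.
    have h2 : C2 ≤ max 1 (max C1 C2) ^ 2 := by
      have a1 : (1 : ℝ) ≤ max 1 (max C1 C2) := le_max_left _ _
      have a2 : C2 ≤ max 1 (max C1 C2) := (le_max_right _ _).trans (le_max_right _ _)
      nlinarith
    calc |-deriv b s - -deriv b t| = |deriv b s - deriv b t| := by
          rw [← abs_neg]; congr 1; ring
      _ ≤ C2 * |s - t| := h1
      _ ≤ _ := by gcongr
  · have : b s = 1 := b.one_of_mem_closedBall (by simpa [b] using hs.le)
    simp [this]
  · have : b s = 0 := b.zero_of_le_dist (by simpa [b] using hs.le)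
    simp [this]

theorem isCutoff_comp_sin {k : ℕ} {χ χ' : ℝ → ℝ} {C : ℝ} (hC : 1 ≤ C)
    (hχ : ∀ s, HasDerivAt χ (χ' s) s) (h1 : ∀ s, |χ s| ≤ 1) (h2 : ∀ s, |χ' s| ≤ C)
    (h3 : ∀ s t, |χ' s - χ' t| ≤ C ^ 2 * |s - t|) {r δ : ℝ} (hr : 0 < r) (hδ : 0 < δ)
    (hδ1 : δ ≤ 1) (i : Fin k) :
    ∃ φ', IsCutoff (fun x : Euc k => χ (Real.sin (Real.pi * (x i / r)) / δ)) φ'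
      (2 * C * Real.pi / (δ * r)) := by
  have hpi := Real.pi_pos
  set T : ℝ := Real.pi / (δ * r) with hT
  have hTpos : 0 < T := by positivity
  have hTr : Real.pi / r ≤ T := by
    rw [hT]; gcongr; nlinarith
  have hTe : 2 * C * Real.pi / (δ * r) = 2 * C * T := by rw [hT]; ring
  rw [hTe]
  let σ : ℝ → ℝ := fun t => Real.sin (Real.pi * (t / r)) / δ
  let g : ℝ → ℝ := fun t => χ' (σ t) * (Real.cos (Real.pi * (t / r)) * T)
  have hσ : ∀ t, HasDerivAt σ (Real.cos (Real.pi * (t / r)) * T) t := fun t => by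
    have := (((hasDerivAt_id t).div_const r).const_mul Real.pi).sin.div_const δ
    convert! this using 1
    rw [hT]; simp only [id]; field_simp
  have hg : ∀ t, HasDerivAt (fun t => χ (σ t)) (g t) t := fun t => (hχ _).comp t (hσ t)
  have hcos : ∀ t, |Real.cos (Real.pi * (t / r)) * T| ≤ T := fun t => by
    rw [abs_mul, abs_of_pos hTpos]
    exact mul_le_of_le_one_left hTpos.le (Real.abs_cos_le_one _)
  have hσl : ∀ s t, |σ s - σ t| ≤ T * |s - t| := fun s t =>
    Convex.norm_image_sub_le_of_norm_hasDerivWithin_le (s := univ) (f := σ)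
      (fun x _ => (hσ x).hasDerivWithinAt) (fun x _ => hcos x) convex_univ (mem_univ t) (mem_univ s)
  have hcl : ∀ s t, |Real.cos (Real.pi * (s / r)) * T - Real.cos (Real.pi * (t / r)) * T| ≤
      T ^ 2 * |s - t| := fun s t => by
    rw [← sub_mul, abs_mul, abs_of_pos hTpos]
    have h := Real.abs_cos_sub_cos_le (Real.pi * (s / r)) (Real.pi * (t / r))
    have e : |Real.pi * (s / r) - Real.pi * (t / r)| = Real.pi / r * |s - t| := by
      rw [show Real.pi * (s / r) - Real.pi * (t / r) = Real.pi / r * (s - t) by ring, abs_mul,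
        abs_of_pos (show 0 < Real.pi / r by positivity)]
    rw [e] at h
    calc _ ≤ Real.pi / r * |s - t| * T := by gcongr
      _ ≤ T * |s - t| * T := by gcongr
      _ = _ := by ring
  have hgb : ∀ t, |g t| ≤ C * T := fun t => by
    rw [abs_mul]
    exact mul_le_mul (h2 _) (hcos t) (abs_nonneg _) (by linarith)
  have hgl : ∀ s t, |g s - g t| ≤ (2 * C * T) ^ 2 * |s - t| := fun s t => by
    have e : g s - g t = (χ' (σ s) - χ' (σ t)) * (Real.cos (Real.pi * (s / r)) * T) +
        χ' (σ t) * (Real.cos (Real.pi * (s / r)) * T - Real.cos (Real.pi * (t / r)) * T) := by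
      simp only [g]; ring
    rw [e]
    refine (abs_add_le _ _).trans ?_
    rw [abs_mul (χ' (σ s) - χ' (σ t)), abs_mul (χ' (σ t))]
    have a1 : |χ' (σ s) - χ' (σ t)| * |Real.cos (Real.pi * (s / r)) * T| ≤
        C ^ 2 * (T * |s - t|) * T :=
      mul_le_mul ((h3 _ _).trans (by gcongr; exact hσl s t)) (hcos s) (abs_nonneg _)
        (by positivity)
    have a2 : |χ' (σ t)| * |Real.cos (Real.pi * (s / r)) * T - Real.cos (Real.pi * (t / r)) * T| ≤
        C * (T ^ 2 * |s - t|) := mul_le_mul (h2 _) (hcl s t) (abs_nonneg _) (by linarith)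
    have a3 : 0 ≤ T ^ 2 * |s - t| := by positivity
    calc _ ≤ C ^ 2 * (T * |s - t|) * T + C * (T ^ 2 * |s - t|) := add_le_add a1 a2
      _ = (C ^ 2 + C) * (T ^ 2 * |s - t|) := by ring
      _ ≤ (4 * C ^ 2) * (T ^ 2 * |s - t|) := by gcongr; nlinarith
      _ = _ := by ring
  obtain ⟨L, hL⟩ : ∃ L : Euc k →L[ℝ] ℝ, ∀ x, L x = x i := ⟨EuclideanSpace.proj i, fun x => rfl⟩
  have hproj : ‖L‖ ≤ 1 :=
    ContinuousLinearMap.opNorm_le_bound _ zero_le_one fun x => by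
      rw [one_mul, hL]; exact PiLp.norm_apply_le x i
  refine ⟨fun x => g (x i) • L, fun x => ?_, fun x => h1 _,
    fun x => ?_, fun x y => ?_⟩
  · have h := HasDerivAt.comp_hasFDerivAt (f := L) x (by rw [hL]; exact hg (x i)) L.hasFDerivAt
    simpa only [Function.comp_def, hL] using h
  · rw [norm_smul]
    calc _ ≤ C * T * 1 := mul_le_mul (hgb _) hproj (norm_nonneg _) (by positivity)
      _ ≤ _ := by nlinarith [mul_pos (by linarith : 0 < C) hTpos]
  · have e : g (x i) • L - g (y i) • L = (g (x i) - g (y i)) • L := by module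
    rw [e, norm_smul, Real.norm_eq_abs]
    have a1 : |x i - y i| ≤ ‖x - y‖ := PiLp.norm_apply_le (x - y) i
    calc _ ≤ (2 * C * T) ^ 2 * |x i - y i| * 1 :=
          mul_le_mul (hgl _ _) hproj (norm_nonneg _) (by positivity)
      _ ≤ _ := by rw [mul_one]; gcongr

/-- Cutoff functions adapted to the grid of mesh `r`: they vanish near the faces of the cells and
equal one at relative distance at least `δ` from them. -/
theorem exists_grid_cutoff (k : ℕ) : ∃ Λ : ℝ, 1 ≤ Λ ∧ ∀ r δ : ℝ, 0 < r → 0 < δ → δ ≤ 1 →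
    ∃ (Φ : Euc k → ℝ) (Φ' : Euc k → Euc k →L[ℝ] ℝ), IsCutoff Φ Φ' (Λ / (δ * r)) ∧
      (∀ x, (∀ i, δ ≤ distInt (x i / r)) → Φ x = 1 ∧ Φ' x = 0) ∧
      ∀ x, (∃ i, ∃ z : ℤ, x i / r = z) → (Φ x = 0 ∧ Φ' x = 0) ∧ ∀ᶠ y in nhds x, Φ y = 0 := by
  obtain ⟨χ, χ', C, hC, hχ, h1, h2, h3, hz, ho⟩ := exists_cutoff_profile
  refine ⟨max 1 (k * (2 * C * Real.pi)), le_max_left _ _, fun r δ hr hδ hδ1 => ?_⟩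
  choose φ' hφ' using fun i : Fin k => isCutoff_comp_sin hC hχ h1 h2 h3 hr hδ hδ1 i
  obtain ⟨Φ', hΦ⟩ := IsCutoff.exists_prod Finset.univ hφ'
  have hcont : ∀ i : Fin k, Continuous fun x : Euc k => |Real.sin (Real.pi * (x i / r)) / δ| :=
    fun i => by fun_prop
  refine ⟨_, Φ', hΦ.mono ?_, fun x hx => ?_, fun x ⟨i, z, hi⟩ => ?_⟩
  · rw [Finset.card_univ, Fintype.card_fin, ← mul_div_assoc]
    gcongr
    exact le_max_right _ _
  · have hev : ∀ᶠ y in nhds x, ∏ i, χ (Real.sin (Real.pi * (y i / r)) / δ) = 1 := by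
      -- At `x` the quotient is at least `2`, strictly above the threshold `3 / 2`. The strict
      -- inequality persists nearby, so the cutoff is locally constant and its derivative vanishes
      -- even on the boundary of the core.
      have : ∀ᶠ y : Euc k in nhds x, ∀ i, 3 / 2 < |Real.sin (Real.pi * (y i / r)) / δ| := by
        refine Filter.eventually_all.2 fun i => ?_
        refine (hcont i).continuousAt.eventually_const_lt ?_
        have := two_mul_distInt_le_abs_sin (x i / r)
        simp only
        rw [abs_div, abs_of_pos hδ, lt_div_iff₀ hδ]
        linarith [hx i]
      filter_upwards [this] with y hy
      exact Finset.prod_eq_one fun i _ => ho _ (hy i)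
    refine ⟨hev.self_of_nhds, ?_⟩
    have hc : HasFDerivAt (fun y : Euc k => ∏ i, χ (Real.sin (Real.pi * (y i / r)) / δ))
      (0 : Euc k →L[ℝ] ℝ) x := (hasFDerivAt_const (1 : ℝ) x).congr_of_eventuallyEq hev
    exact (hΦ.hasFDerivAt x).unique hc
  · have hev : ∀ᶠ y in nhds x, ∏ i, χ (Real.sin (Real.pi * (y i / r)) / δ) = 0 := by
      have : ∀ᶠ y : Euc k in nhds x, |Real.sin (Real.pi * (y i / r)) / δ| < 1 := by
        refine (hcont i).continuousAt.eventually_lt_const ?_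
        simp only
        rw [hi, mul_comm, Real.sin_int_mul_pi]; simp
      filter_upwards [this] with y hy
      exact Finset.prod_eq_zero (Finset.mem_univ i) (hz _ hy)
    have hc : HasFDerivAt (fun y : Euc k => ∏ i, χ (Real.sin (Real.pi * (y i / r)) / δ))
      (0 : Euc k →L[ℝ] ℝ) x := (hasFDerivAt_const (0 : ℝ) x).congr_of_eventuallyEq hev
    exact ⟨⟨hev.self_of_nhds, (hΦ.hasFDerivAt x).unique hc⟩, hev⟩

/-! ### Cells and cores of cubic grids -/

/-- Two points lie in the same half-open cell of the cubic grid of mesh `r`. -/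
def SameCell {k : ℕ} (r : ℝ) (x y : Euc k) : Prop := ∀ i, ⌊x i / r⌋ = ⌊y i / r⌋

namespace SameCell

variable {k : ℕ} {r : ℝ} {x y z : Euc k}

theorem refl (r : ℝ) (x : Euc k) : SameCell r x x := fun _ => rfl

theorem symm (h : SameCell r x y) : SameCell r y x := fun i => (h i).symm

theorem trans (h : SameCell r x y) (h' : SameCell r y z) : SameCell r x z :=
  fun i => (h i).trans (h' i)

/-- A cell of mesh `r` has diameter at most `k r`. -/
theorem norm_sub_le (hr : 0 < r) (h : SameCell r x y) : ‖x - y‖ ≤ k * r := by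
  have h1 : ∀ i, |x i - y i| ≤ r := fun i => by
    have := Int.abs_sub_lt_one_of_floor_eq_floor (h i)
    rw [← sub_div, abs_div, abs_of_pos hr, div_lt_one hr] at this
    exact this.le
  rw [EuclideanSpace.norm_eq]
  refine Real.sqrt_le_iff.2 ⟨by positivity, ?_⟩
  calc ∑ i, ‖(x - y) i‖ ^ 2 ≤ ∑ _i : Fin k, r ^ 2 := by
        refine Finset.sum_le_sum fun i _ => ?_
        have := h1 i
        rw [PiLp.sub_apply, Real.norm_eq_abs]
        gcongr
    _ = k * r ^ 2 := by simp
    _ ≤ (k * r) ^ 2 := by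
        rw [mul_pow]
        gcongr
        rcases Nat.eq_zero_or_pos k with rfl | hk
        · simp
        · have : (1 : ℝ) ≤ k := by exact_mod_cast hk
          nlinarith

/-- Halving the mesh refines the grid. -/
theorem of_half (h : SameCell (r / 2) x y) : SameCell r x y := by
  have key : ∀ t : ℝ, ⌊t / r⌋ = ⌊t / (r / 2)⌋ / 2 := fun t => by
    have h2 := Int.floor_div_natCast (t / (r / 2)) 2
    rw [← Nat.cast_ofNat (R := ℤ), ← h2]
    congr 1
    push_cast
    ring
  intro i
  rw [key, key, h i]

end SameCell

/-- The segment from `x` to `y` crosses a face, and `p` is the crossing point. Since a cut-off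
correction and its derivative vanish on faces, the exact splitting of the distance turns bounds in
terms of the distance to `p` into a Lipschitz bound across cells. -/
theorem exists_grid_point_of_not_sameCell {k : ℕ} {r : ℝ} {x y : Euc k}
    (h : ¬ SameCell r x y) :
    ∃ p : Euc k, (∃ i, ∃ z : ℤ, p i / r = z) ∧ ‖x - p‖ + ‖y - p‖ = ‖x - y‖ := by
  unfold SameCell at h
  push Not at h
  obtain ⟨i, hi⟩ := h
  wlog hlt : ⌊x i / r⌋ < ⌊y i / r⌋ generalizing x y
  · obtain ⟨p, hp, hxy⟩ := this hi.symm (lt_of_le_of_ne (not_lt.1 hlt) hi.symm)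
    exact ⟨p, hp, by rw [add_comm, hxy, norm_sub_rev]⟩
  obtain ⟨z, hz1, hz2⟩ := exists_int_mem_Icc_of_floor_lt hlt
  have hxy : x i / r < y i / r := by
    by_contra hcon
    exact absurd (Int.floor_mono (not_lt.1 hcon)) (not_le.2 hlt)
  set c : ℝ := (z - x i / r) / (y i / r - x i / r) with hc
  have hd : 0 < y i / r - x i / r := sub_pos.2 hxy
  have hc0 : 0 ≤ c := div_nonneg (sub_nonneg.2 hz1) hd.le
  have hc1 : c ≤ 1 := (div_le_one hd).2 (by linarith)
  refine ⟨x + c • (y - x), ⟨i, z, ?_⟩, ?_⟩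
  · have e : (x + c • (y - x)) i = x i + c * (y i - x i) := by simp
    rw [e]
    have : c * (y i / r - x i / r) = z - x i / r := by
      rw [hc]; exact div_mul_cancel₀ _ hd.ne'
    rw [add_div, mul_div_assoc, sub_div, this]; ring
  · have e1 : x - (x + c • (y - x)) = c • (x - y) := by module
    have e2 : y - (x + c • (y - x)) = (c - 1) • (x - y) := by module
    rw [e1, e2, norm_smul, norm_smul, Real.norm_of_nonneg hc0, Real.norm_of_nonpos (by linarith)]
    ring

/-- Off the grid faces, cells are open. -/
theorem eventually_sameCell {k : ℕ} {r : ℝ} {x : Euc k}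
    (h : ¬ ∃ i, ∃ z : ℤ, x i / r = z) : ∀ᶠ y in nhds x, SameCell r x y := by
  refine Filter.eventually_all.2 fun i => ?_
  have hc : ContinuousAt (fun y : Euc k => y i / r) x := by fun_prop
  have hlt : (⌊x i / r⌋ : ℝ) < x i / r :=
    lt_of_le_of_ne (Int.floor_le _) fun he => h ⟨i, _, he.symm⟩
  filter_upwards [hc.eventually_const_lt hlt, hc.eventually_lt_const (Int.lt_floor_add_one _)]
    with y h1 h2
  exact (Int.floor_eq_iff.2 ⟨h1.le, h2⟩).symm

/-- The points at relative distance at least `δ` from the faces of the grid of mesh `r`. -/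
def gridCore (k : ℕ) (r δ : ℝ) : Set (Euc k) := {x | ∀ i, δ ≤ distInt (x i / r)}

theorem isClosed_gridCore (k : ℕ) (r δ : ℝ) : IsClosed (gridCore k r δ) := by
  simp only [gridCore, Set.ofPred_forall]
  refine isClosed_iInter fun i => isClosed_le continuous_const ?_
  exact continuous_distInt.comp (by fun_prop)

/-- Leaving the cell of a core point costs at least the width of the gap; the other point is
unrestricted. -/
theorem le_norm_sub_of_not_sameCell {k : ℕ} {r δ : ℝ} (hr : 0 < r)
    {x y : Euc k} (hx : x ∈ gridCore k r δ) (h : ¬ SameCell r x y) : δ * r ≤ ‖x - y‖ := by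
  unfold SameCell at h
  push Not at h
  obtain ⟨i, hi⟩ := h
  have h1 := distInt_add_distInt_le_of_floor_ne hi
  have h2 := hx i
  have h3 := distInt_nonneg (y i / r)
  rw [← sub_div, abs_div, abs_of_pos hr] at h1
  have h4 : δ ≤ |x i - y i| / r := by linarith
  rw [le_div_iff₀ hr] at h4
  exact h4.trans (PiLp.norm_apply_le (x - y) i)

/-! ### Cut-off cellwise affine corrections -/

/-- The cellwise affine function `x ↦ A (x - b)`, cut off near the faces of the grid. -/
noncomputable def cellBump {k m : ℕ} (Φ : Euc k → ℝ) (A : Euc k → Euc k →L[ℝ] Euc m)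
    (b : Euc k → Euc k) (x : Euc k) : Euc m := Φ x • A x (x - b x)

/-- The derivative of `cellBump`. -/
noncomputable def cellBumpDeriv {k m : ℕ} (Φ : Euc k → ℝ) (Φ' : Euc k → Euc k →L[ℝ] ℝ)
    (A : Euc k → Euc k →L[ℝ] Euc m) (b : Euc k → Euc k) (x : Euc k) : Euc k →L[ℝ] Euc m :=
  Φ x • A x + (Φ' x).smulRight (A x (x - b x))

section CellBump

variable {k m : ℕ} {r t a D : ℝ} {Φ : Euc k → ℝ} {Φ' : Euc k → Euc k →L[ℝ] ℝ}
  {A : Euc k → Euc k →L[ℝ] Euc m} {b : Euc k → Euc k}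

/-- The alternative in `hD` accounts for cells without a base point: there `b` is a default value
carrying no distance bound, but the defect is zero. -/
theorem norm_cell_apply_le (ha : ∀ x, ‖A x‖ ≤ a) (hD0 : 0 ≤ D)
    (hD : ∀ x, A x = 0 ∨ ‖x - b x‖ ≤ D) (x : Euc k) : ‖A x (x - b x)‖ ≤ a * D := by
  have ha0 : 0 ≤ a := (norm_nonneg _).trans (ha x)
  rcases hD x with h | h
  · rw [h]; simp; positivity
  · exact ((A x).le_opNorm _).trans (mul_le_mul (ha x) h (norm_nonneg _) ha0)

theorem norm_cellBumpDeriv_le (hΦ : IsCutoff Φ Φ' t) (ha : ∀ x, ‖A x‖ ≤ a) (hD0 : 0 ≤ D)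
    (hD : ∀ x, A x = 0 ∨ ‖x - b x‖ ≤ D) (x : Euc k) :
    ‖cellBumpDeriv Φ Φ' A b x‖ ≤ a + t * (a * D) := by
  refine (norm_add_le _ _).trans ?_
  rw [norm_smul, ContinuousLinearMap.norm_smulRight_apply, Real.norm_eq_abs]
  have ht : 0 ≤ t := (norm_nonneg _).trans (hΦ.norm_deriv_le x)
  refine add_le_add ?_ ?_
  · calc _ ≤ 1 * a := mul_le_mul (hΦ.abs_le_one x) (ha x) (norm_nonneg _) zero_le_one
      _ = a := one_mul a
  · exact mul_le_mul (hΦ.norm_deriv_le x) (norm_cell_apply_le ha hD0 hD x) (norm_nonneg _) ht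

/-- Near a face the function is identically zero, which hides the jumps of `A` and `b`; elsewhere
both are locally constant. -/
theorem hasFDerivAt_cellBump (hΦ : IsCutoff Φ Φ' t)
    (hΦ0 : ∀ x, (∃ i, ∃ z : ℤ, x i / r = z) → (Φ x = 0 ∧ Φ' x = 0) ∧ ∀ᶠ y in nhds x, Φ y = 0)
    (hA : ∀ x y, SameCell r x y → A x = A y) (hb : ∀ x y, SameCell r x y → b x = b y)
    (x : Euc k) : HasFDerivAt (cellBump Φ A b) (cellBumpDeriv Φ Φ' A b x) x := by
  by_cases hx : ∃ i, ∃ z : ℤ, x i / r = z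
  · obtain ⟨⟨h1, h2⟩, h3⟩ := hΦ0 x hx
    have e : cellBumpDeriv Φ Φ' A b x = 0 := by
      rw [cellBumpDeriv, h1, h2]; ext; simp
    rw [e]
    refine (hasFDerivAt_const (0 : Euc m) x).congr_of_eventuallyEq ?_
    filter_upwards [h3] with y hy
    simp [cellBump, hy]
  · have h1 : HasFDerivAt (fun y => Φ y • A x (y - b x)) (cellBumpDeriv Φ Φ' A b x) x := by
      have h2 : HasFDerivAt (fun y => A x (y - b x)) (A x) x :=
        (A x).hasFDerivAt.comp x ((hasFDerivAt_id x).sub_const (b x))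
      exact (hΦ.hasFDerivAt x).smul h2
    refine h1.congr_of_eventuallyEq ?_
    filter_upwards [eventually_sameCell hx] with y hy
    rw [cellBump, hA x y hy, hb x y hy]

theorem norm_cellBumpDeriv_le_of_grid_point (hΦ : IsCutoff Φ Φ' t) (ha : ∀ x, ‖A x‖ ≤ a)
    (hD0 : 0 ≤ D) (hD : ∀ x, A x = 0 ∨ ‖x - b x‖ ≤ D) (x p : Euc k) (hp : Φ p = 0 ∧ Φ' p = 0) :
    ‖cellBumpDeriv Φ Φ' A b x‖ ≤ (2 * t * a + t ^ 2 * (a * D)) * ‖x - p‖ := by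
  have ht : 0 ≤ t := (norm_nonneg _).trans (hΦ.norm_deriv_le x)
  have ha0 : 0 ≤ a := (norm_nonneg _).trans (ha x)
  have h1 := hΦ.abs_sub_le x p
  have h2 := hΦ.norm_deriv_sub_le x p
  rw [hp.1, sub_zero] at h1
  rw [hp.2, sub_zero] at h2
  refine (norm_add_le _ _).trans ?_
  rw [norm_smul, ContinuousLinearMap.norm_smulRight_apply, Real.norm_eq_abs]
  have h3 := mul_le_mul h1 (ha x) (norm_nonneg _) (mul_nonneg ht (norm_nonneg _))
  have h4 := mul_le_mul h2 (norm_cell_apply_le ha hD0 hD x) (norm_nonneg _) (by positivity)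
  have h5 : 0 ≤ t * a * ‖x - p‖ := by positivity
  nlinarith

theorem norm_cellBumpDeriv_sub_le (hΦ : IsCutoff Φ Φ' t)
    (hΦ0 : ∀ x, (∃ i, ∃ z : ℤ, x i / r = z) → (Φ x = 0 ∧ Φ' x = 0) ∧ ∀ᶠ y in nhds x, Φ y = 0)
    (hA : ∀ x y, SameCell r x y → A x = A y) (hb : ∀ x y, SameCell r x y → b x = b y)
    (ha : ∀ x, ‖A x‖ ≤ a) (hD0 : 0 ≤ D) (hD : ∀ x, A x = 0 ∨ ‖x - b x‖ ≤ D) (x y : Euc k) :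
    ‖cellBumpDeriv Φ Φ' A b x - cellBumpDeriv Φ Φ' A b y‖ ≤
      (2 * t * a + t ^ 2 * (a * D)) * ‖x - y‖ := by
  by_cases h : SameCell r x y
  · have ht : 0 ≤ t := (norm_nonneg _).trans (hΦ.norm_deriv_le x)
    have ha0 : 0 ≤ a := (norm_nonneg _).trans (ha x)
    -- Within one cell `A` and `b` are constant, so the difference is the sum of the variations of
    -- `Φ`, of `Φ'`, and of the affine factor.
    have e : cellBumpDeriv Φ Φ' A b x - cellBumpDeriv Φ Φ' A b y = (Φ x - Φ y) • A x +
        (Φ' x - Φ' y).smulRight (A x (x - b x)) + (Φ' y).smulRight (A x (x - y)) := by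
      ext v
      simp only [cellBumpDeriv, ← hA x y h, ← hb x y h, map_sub, sub_apply,
        add_apply, smul_apply,
        ContinuousLinearMap.smulRight_apply, PiLp.add_apply, PiLp.sub_apply, PiLp.smul_apply,
        smul_eq_mul]
      ring
    rw [e]
    refine (norm_add₃_le).trans ?_
    rw [norm_smul, ContinuousLinearMap.norm_smulRight_apply,
      ContinuousLinearMap.norm_smulRight_apply, Real.norm_eq_abs]
    have h1 := mul_le_mul (hΦ.abs_sub_le x y) (ha x) (norm_nonneg _)
      (mul_nonneg ht (norm_nonneg _))
    have h2 := mul_le_mul (hΦ.norm_deriv_sub_le x y) (norm_cell_apply_le ha hD0 hD x)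
      (norm_nonneg _) (by positivity)
    have h3 := mul_le_mul (hΦ.norm_deriv_le y) (((A x).le_opNorm (x - y)).trans
      (mul_le_mul_of_nonneg_right (ha x) (norm_nonneg _))) (norm_nonneg _) ht
    nlinarith
  -- Across cells both derivatives are compared with the value zero at the face point `p`.
  · obtain ⟨p, hp, hpe⟩ := exists_grid_point_of_not_sameCell h
    have h1 := norm_cellBumpDeriv_le_of_grid_point hΦ ha hD0 hD x p (hΦ0 p hp).1
    have h2 := norm_cellBumpDeriv_le_of_grid_point hΦ ha hD0 hD y p (hΦ0 p hp).1
    rw [← hpe, mul_add]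
    exact (norm_sub_le _ _).trans (add_le_add h1 h2)

end CellBump

/-- Interpolation between a bound and a Lipschitz bound. -/
theorem le_rpow_mul_of_le_of_le {d B L ρ θ : ℝ} (hd : 0 ≤ d) (hB : 0 ≤ B) (hL : 0 ≤ L)
    (hρ : 0 ≤ ρ) (hθ0 : 0 ≤ θ) (hθ1 : θ ≤ 1) (h1 : d ≤ B) (h2 : d ≤ L * ρ) :
    d ≤ B ^ (1 - θ) * L ^ θ * ρ ^ θ := by
  rw [mul_assoc, ← Real.mul_rpow hL hρ]
  calc d = d ^ (1 - θ) * d ^ θ := by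
        rw [← Real.rpow_add_of_nonneg hd (by linarith) hθ0]; simp
    _ ≤ _ := by
        gcongr

/-! ### The iterative correction scheme -/

section CorrectionScheme

variable {k m : ℕ}

/-- The points of `E` that lie in all the sets `core j` with `j < n`. -/
def stageSet (E : Set (Euc k)) (core : ℕ → Set (Euc k)) (n : ℕ) : Set (Euc k) :=
  {x | x ∈ E ∧ ∀ j < n, x ∈ core j}

open Classical in
/-- A point of `S` chosen in the cell of `x`, if there is one. -/
noncomputable def cellBase (S : Set (Euc k)) (r : ℝ) (x : Euc k) : Euc k :=
  if h : ∃ y, y ∈ S ∧ SameCell r y x then h.choose else 0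

open Classical in
/-- The defect of the approximate gradient `P` of `U` at the base point of each cell. -/
noncomputable def cellDefect (F : Euc k × Euc m → (Euc k →L[ℝ] Euc m)) (S : Set (Euc k)) (r : ℝ)
    (U : Euc k → Euc m) (P : Euc k → Euc k →L[ℝ] Euc m) (x : Euc k) : Euc k →L[ℝ] Euc m :=
  if ∃ y, y ∈ S ∧ SameCell r y x then
    F (cellBase S r x, U (cellBase S r x)) - P (cellBase S r x) else 0

/-- Equality of the predicates, rather than equivalence of the existence statements, is what forces
the choice operator to select the same base point throughout a cell. -/
theorem exists_mem_sameCell_eq {S : Set (Euc k)} {r : ℝ} {x x' : Euc k} (h : SameCell r x x') :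
    (fun y => y ∈ S ∧ SameCell r y x) = fun y => y ∈ S ∧ SameCell r y x' := by
  funext y
  exact propext ⟨fun ⟨h1, h2⟩ => ⟨h1, h2.trans h⟩, fun ⟨h1, h2⟩ => ⟨h1, h2.trans h.symm⟩⟩

open Classical in
theorem cellBase_congr {S : Set (Euc k)} {r : ℝ} {x x' : Euc k} (h : SameCell r x x') :
    cellBase S r x = cellBase S r x' := by
  have key : ∀ p q : Euc k → Prop, p = q → (if h : ∃ y, p y then h.choose else 0) =
      (if h : ∃ y, q y then h.choose else 0) := by
    rintro p _ rfl; rfl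
  exact key _ _ (exists_mem_sameCell_eq h)

theorem cellDefect_congr {F : Euc k × Euc m → (Euc k →L[ℝ] Euc m)} {S : Set (Euc k)} {r : ℝ}
    {U : Euc k → Euc m} {P : Euc k → Euc k →L[ℝ] Euc m} {x x' : Euc k} (h : SameCell r x x') :
    cellDefect F S r U P x = cellDefect F S r U P x' := by
  have e : (∃ y, y ∈ S ∧ SameCell r y x) = ∃ y, y ∈ S ∧ SameCell r y x' :=
    congrArg Exists (exists_mem_sameCell_eq h)
  simp only [cellDefect, cellBase_congr h]
  by_cases hx : ∃ y, y ∈ S ∧ SameCell r y x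
  · rw [if_pos hx, if_pos (e.mp hx)]
  · rw [if_neg hx, if_neg (mt e.mpr hx)]

theorem cellBase_spec {S : Set (Euc k)} {r : ℝ} {x : Euc k}
    (h : ∃ y, y ∈ S ∧ SameCell r y x) : cellBase S r x ∈ S ∧ SameCell r (cellBase S r x) x := by
  rw [cellBase, dif_pos h]; exact h.choose_spec

/-- Successive correction of a function and of its approximate gradient. -/
noncomputable def correctionScheme (F : Euc k × Euc m → (Euc k →L[ℝ] Euc m)) (E : Set (Euc k))
    (core : ℕ → Set (Euc k)) (r : ℕ → ℝ) (Φ : ℕ → Euc k → ℝ) :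
    ℕ → (Euc k → Euc m) × (Euc k → Euc k →L[ℝ] Euc m)
  | 0 => (fun _ => 0, fun _ => 0)
  | n + 1 =>
    let s := correctionScheme F E core r Φ n
    (fun x => s.1 x + cellBump (Φ n) (cellDefect F (stageSet E core n) (r n) s.1 s.2)
      (cellBase (stageSet E core n) (r n)) x,
      fun x => s.2 x + cellDefect F (stageSet E core n) (r n) s.1 s.2 x)

/-- Cellwise corrections whose partial sums solve the equation `P = F (x, U x)` up to an error
proportional to the mesh. -/
theorem exists_cell_corrections {F : Euc k × Euc m → (Euc k →L[ℝ] Euc m)} {E : Set (Euc k)}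
    {core : ℕ → Set (Euc k)} {r : ℕ → ℝ} {Φ : ℕ → Euc k → ℝ} {L M η : ℝ}
    (hL : 0 ≤ L) (hM : 0 ≤ M)
    (hFM : ∀ x ∈ E, ∀ p, ‖p‖ ≤ η → ‖F (x, p)‖ ≤ M)
    (hFL : ∀ x ∈ E, ∀ y ∈ E, ∀ p q, ‖p‖ ≤ η → ‖q‖ ≤ η →
      ‖F (x, p) - F (y, q)‖ ≤ L * (‖x - y‖ + ‖p - q‖))
    (hE : ∀ x ∈ E, ∀ y, SameCell (r 0) x y → y ∈ E)
    (hr0 : 0 < r 0) (hr : ∀ n, r (n + 1) = r n / 2) (hη : 4 * M * k * r 0 ≤ η)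
    (hΦ : ∀ n x, |Φ n x| ≤ 1) (hΦ1 : ∀ n, ∀ x ∈ core n, Φ n x = 1) :
    ∃ (A : ℕ → Euc k → Euc k →L[ℝ] Euc m) (b : ℕ → Euc k → Euc k) (C : ℝ), 0 ≤ C ∧
      (∀ n x y, SameCell (r n) x y → A n x = A n y) ∧
      (∀ n x y, SameCell (r n) x y → b n x = b n y) ∧
      (∀ n x, ‖A n x‖ ≤ C * r n) ∧
      (∀ n x, A n x = 0 ∨ ‖x - b n x‖ ≤ k * r n) ∧
      (∀ n x, A n x ≠ 0 → x ∈ E) ∧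
      (∀ n x, ‖cellBump (Φ n) (A n) (b n) x‖ ≤ 2 * M * k * r n) ∧
      ∀ n, ∀ x ∈ stageSet E core n, ‖∑ j ∈ Finset.range n, A j x -
        F (x, ∑ j ∈ Finset.range n, cellBump (Φ j) (A j) (b j) x)‖ ≤ C * r n := by
  set s := correctionScheme F E core r Φ with hs
  set K : ℕ → Set (Euc k) := stageSet E core with hK
  set b : ℕ → Euc k → Euc k := fun n => cellBase (K n) (r n) with hb
  set A : ℕ → Euc k → Euc k →L[ℝ] Euc m := fun n => cellDefect F (K n) (r n) (s n).1 (s n).2 with hA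
  set w : ℕ → Euc k → Euc m := fun n => cellBump (Φ n) (A n) (b n) with hw
  have hU0 : ∀ x, (s 0).1 x = 0 := fun x => rfl
  have hP0 : ∀ x, (s 0).2 x = 0 := fun x => rfl
  have hU : ∀ n x, (s (n + 1)).1 x = (s n).1 x + w n x := fun n x => rfl
  have hP : ∀ n x, (s (n + 1)).2 x = (s n).2 x + A n x := fun n x => rfl
  have hrpos : ∀ n, 0 < r n := fun n => by
    induction n with
    | zero => exact hr0
    | succ n ih => rw [hr]; linarith
  have hcell : ∀ n (x y : Euc k), SameCell (r (n + 1)) x y → SameCell (r n) x y := fun n x y h => by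
    rw [hr] at h; exact h.of_half
  have hcell0 : ∀ n (x y : Euc k), SameCell (r n) x y → SameCell (r 0) x y := fun n x y h => by
    induction n with
    | zero => exact h
    | succ n ih => exact ih (hcell n x y h)
  have hKs : ∀ n x, x ∈ K (n + 1) → x ∈ K n ∧ x ∈ core n := fun n x hx =>
    ⟨⟨hx.1, fun j hj => hx.2 j (by omega)⟩, hx.2 n (by omega)⟩
  have hAc : ∀ n x y, SameCell (r n) x y → A n x = A n y := fun n x y h => cellDefect_congr h
  have hbc : ∀ n x y, SameCell (r n) x y → b n x = b n y := fun n x y h => cellBase_congr h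
  have hAb : ∀ n x, (∃ y, y ∈ K n ∧ SameCell (r n) y x) →
      A n x = F (b n x, (s n).1 (b n x)) - (s n).2 (b n x) := fun n x h => by
    simp only [hA, cellDefect, if_pos h, hb]
  have hA0 : ∀ n x, (¬ ∃ y, y ∈ K n ∧ SameCell (r n) y x) → A n x = 0 := fun n x h => by
    simp only [hA, cellDefect, if_neg h]
  have hPc : ∀ n x y, SameCell (r n) x y → (s n).2 x = (s n).2 y := fun n => by
    induction n with
    | zero => intro x y _; rw [hP0, hP0]
    | succ n ih =>
      intro x y h
      rw [hP, hP, ih x y (hcell n x y h), hAc n x y (hcell n x y h)]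
  -- The previous approximate gradient is constant on the cell of mesh `r n`, so adding the defect
  -- at the base point replaces it by the value of `F` there.
  have hPn : ∀ n x, x ∈ K n → (s (n + 1)).2 x = F (b n x, (s n).1 (b n x)) := fun n x hx => by
    have hex : ∃ y, y ∈ K n ∧ SameCell (r n) y x := ⟨x, hx, SameCell.refl _ _⟩
    rw [hP, hAb n x hex, hPc n x (b n x) (cellBase_spec hex).2.symm]
    abel
  have hdist : ∀ n x, A n x = 0 ∨ ‖x - b n x‖ ≤ k * r n := fun n x => by
    by_cases hex : ∃ y, y ∈ K n ∧ SameCell (r n) y x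
    · exact Or.inr ((cellBase_spec hex).2.symm.norm_sub_le (hrpos n))
    · exact Or.inl (hA0 n x hex)
  -- Three invariants are carried together: `U` stays in the ball where the bounds on `F` hold, `P`
  -- is bounded on the good set, and there `U` is affine on each cell with gradient `P`. The sup
  -- bound telescopes, because the `n`-th correction is at most `2 * M * k * r n = 4 * M * k * (r n
  -- - r (n + 1))`.
  have main : ∀ n, (∀ x, ‖(s n).1 x‖ ≤ 4 * M * k * (r 0 - r n)) ∧
      (∀ x ∈ K n, ‖(s n).2 x‖ ≤ M) ∧
      (∀ x y, x ∈ K n → y ∈ K n → SameCell (r n) x y →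
        (s n).1 x - (s n).1 y = (s n).2 x (x - y)) := fun n => by
    induction n with
    | zero =>
      refine ⟨fun x => ?_, fun x _ => ?_, fun x y _ _ _ => ?_⟩
      · rw [hU0]; simp
      · rw [hP0]; simpa using hM
      · rw [hU0, hU0, hP0]; simp
    | succ n ih =>
      obtain ⟨ih1, ih2, ih3⟩ := ih
      have hUη : ∀ x, ‖(s n).1 x‖ ≤ η := fun x => (ih1 x).trans (le_trans (by
        have := (hrpos n).le
        have h4 : 0 ≤ 4 * M * k := by positivity
        nlinarith) hη)
      have hA2 : ∀ x, ‖A n x‖ ≤ 2 * M := fun x => by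
        by_cases hex : ∃ y, y ∈ K n ∧ SameCell (r n) y x
        · rw [hAb n x hex]
          have hbK := (cellBase_spec hex).1
          have h1 := hFM (b n x) hbK.1 _ (hUη (b n x))
          have h2 := ih2 (b n x) hbK
          exact (norm_sub_le _ _).trans (by linarith)
        · rw [hA0 n x hex]; simpa using hM
      have hwn : ∀ x, ‖w n x‖ ≤ 2 * M * (k * r n) := fun x => by
        simp only [hw, cellBump]
        rw [norm_smul, Real.norm_eq_abs, ← one_mul (2 * M * (k * r n))]
        exact mul_le_mul (hΦ n x) (norm_cell_apply_le hA2
          (mul_nonneg (Nat.cast_nonneg k) (hrpos n).le) (hdist n) x) (norm_nonneg _) zero_le_one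
      refine ⟨fun x => ?_, fun x hx => ?_, fun x y hx hy hxy => ?_⟩
      · rw [hU, hr]
        refine (norm_add_le _ _).trans ?_
        have h1 := ih1 x
        have h2 := hwn x
        nlinarith
      · have hx' := (hKs n x hx).1
        rw [hPn n x hx']
        have hex : ∃ y, y ∈ K n ∧ SameCell (r n) y x := ⟨x, hx', SameCell.refl _ _⟩
        exact hFM _ (cellBase_spec hex).1.1 _ (hUη _)
      · have hxK := hKs n x hx
        have hyK := hKs n y hy
        have hxy' := hcell n x y hxy
        have h1 := ih3 x y hxK.1 hyK.1 hxy'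
        -- Both points are in the core of level `n`, so the cutoff equals one and the correction is
        -- exactly affine between them.
        have h2 : w n x - w n y = A n x (x - y) := by
          simp only [hw, cellBump]
          rw [hΦ1 n x hxK.2, hΦ1 n y hyK.2, ← hAc n x y hxy', ← hbc n x y hxy', one_smul, one_smul,
            ← map_sub]
          congr 1; abel
        rw [hU, hU, hP, add_apply, ← h1, ← h2]
        abel
  have hUη : ∀ n x, ‖(s n).1 x‖ ≤ η := fun n x => ((main n).1 x).trans (le_trans (by
        have := (hrpos n).le
        have h4 : 0 ≤ 4 * M * k := by positivity
        nlinarith) hη)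
  -- The first entry covers level zero, where the defect is `F` itself; the second comes from the
  -- Lipschitz estimate at later levels, its factor `2` from `r n = 2 * r (n + 1)`.
  set C : ℝ := max (M / r 0) (2 * L * (1 + M) * k) with hC
  have hC0 : 0 ≤ C := le_max_of_le_left (by positivity)
  have herr : ∀ n x, x ∈ K n → ‖(s n).2 x - F (x, (s n).1 x)‖ ≤ C * r n := fun n => by
    cases n with
    | zero =>
      intro x hx
      rw [hP0, zero_sub, norm_neg]
      calc _ ≤ M := hFM x hx.1 _ (hUη 0 x)
        _ = M / r 0 * r 0 := by field_simp
        _ ≤ _ := by gcongr; exact le_max_left _ _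
    | succ n =>
      intro x hx
      have hxK := hKs n x hx
      have hex : ∃ y, y ∈ K n ∧ SameCell (r n) y x := ⟨x, hxK.1, SameCell.refl _ _⟩
      have hbx := cellBase_spec hex
      have hd : ‖x - b n x‖ ≤ k * r n := hbx.2.symm.norm_sub_le (hrpos n)
      -- The new function at `x` is compared with the old one at the base point, which may lie
      -- outside the core of level `n`; this costs nothing, as the correction `A (x - b)` is centred
      -- at `b`.
      have e : (s (n + 1)).1 x - (s n).1 (b n x) = (s (n + 1)).2 x (x - b n x) := by
        have h1 := (main n).2.2 x (b n x) hxK.1 hbx.1 hbx.2.symm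
        have h2 : w n x = A n x (x - b n x) := by
          simp only [hw, cellBump]; rw [hΦ1 n x hxK.2, one_smul]
        rw [hU, hP, add_apply, ← h1, h2]; abel
      have hd2 : ‖(s (n + 1)).1 x - (s n).1 (b n x)‖ ≤ M * (k * r n) := by
        rw [e]
        exact ((ContinuousLinearMap.le_opNorm _ _).trans (mul_le_mul ((main (n + 1)).2.1 x hx) hd
          (norm_nonneg _) hM))
      rw [hPn n x hxK.1, norm_sub_rev]
      calc _ ≤ L * (‖x - b n x‖ + ‖(s (n + 1)).1 x - (s n).1 (b n x)‖) :=
            hFL x hx.1 _ hbx.1.1 _ _ (hUη _ _) (hUη _ _)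
        _ ≤ L * (k * r n + M * (k * r n)) := by gcongr
        _ = 2 * L * (1 + M) * k * r (n + 1) := by rw [hr]; ring
        _ ≤ _ := by
          have := (hrpos (n + 1)).le
          gcongr; exact le_max_right _ _
  have hsumU : ∀ n x, (s n).1 x = ∑ j ∈ Finset.range n, w j x := fun n x => by
    induction n with
    | zero => simp [hU0]
    | succ n ih => rw [hU, ih, Finset.sum_range_succ]
  have hsumP : ∀ n x, (s n).2 x = ∑ j ∈ Finset.range n, A j x := fun n x => by
    induction n with
    | zero => simp [hP0]
    | succ n ih => rw [hP, ih, Finset.sum_range_succ]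
  have hAC : ∀ n x, ‖A n x‖ ≤ C * r n := fun n x => by
    by_cases hex : ∃ y, y ∈ K n ∧ SameCell (r n) y x
    · rw [hAb n x hex, norm_sub_rev]
      exact herr n _ (cellBase_spec hex).1
    · rw [hA0 n x hex, norm_zero]
      exact mul_nonneg hC0 (hrpos n).le
  have hA2 : ∀ n x, ‖A n x‖ ≤ 2 * M := fun n x => by
    by_cases hex : ∃ y, y ∈ K n ∧ SameCell (r n) y x
    · rw [hAb n x hex]
      have hbK := (cellBase_spec hex).1
      have h1 := hFM (b n x) hbK.1 _ (hUη n (b n x))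
      have h2 := (main n).2.1 (b n x) hbK
      exact (norm_sub_le _ _).trans (by linarith)
    · rw [hA0 n x hex]; simpa using hM
  refine ⟨A, b, C, hC0, hAc, hbc, hAC, hdist, fun n x hx => ?_, fun n x => ?_, fun n x hx => ?_⟩
  · by_contra hxE
    refine hx (hA0 n x ?_)
    rintro ⟨y, hy, hyx⟩
    exact hxE (hE y hy.1 x (hcell0 n y x hyx))
  · show ‖w n x‖ ≤ _
    simp only [hw, cellBump]
    rw [norm_smul, Real.norm_eq_abs, ← one_mul (2 * M * k * r n), mul_assoc (2 * M)]
    exact mul_le_mul (hΦ n x) (norm_cell_apply_le (hA2 n)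
      (mul_nonneg (Nat.cast_nonneg k) (hrpos n).le) (hdist n) x) (norm_nonneg _) zero_le_one
  · rw [← hsumP, ← hsumU]
    exact herr n x hx

end CorrectionScheme

/-! ### Series in `Lᵖ` and in fractional Sobolev spaces -/

/-- A weighted power bound for series. -/
theorem ENNReal.tsum_mul_rpow_le {ι : Type*} (w b : ι → ℝ≥0∞) {p : ℝ} (hp : 0 < p) :
    (∑' n, w n * b n) ^ p ≤ (∑' n, w n) ^ p * ∑' n, b n ^ p := by
  set S := ∑' n, b n ^ p with hS
  -- Each `b n` is at most the whole `ℓᵖ` norm; this crude bound suffices because the weights will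
  -- be geometric.
  have hb : ∀ n, b n ≤ S ^ (1 / p) := fun n => by
    rw [one_div, ENNReal.le_rpow_inv_iff hp]
    exact ENNReal.le_tsum n
  calc (∑' n, w n * b n) ^ p ≤ (∑' n, w n * S ^ (1 / p)) ^ p := by
        gcongr with n; exact hb n
    _ = (∑' n, w n) ^ p * S := by
        rw [ENNReal.tsum_mul_right, ENNReal.mul_rpow_of_nonneg _ _ hp.le, ← ENNReal.rpow_mul,
          one_div_mul_cancel hp.ne', ENNReal.rpow_one]

section Series

variable {k : ℕ} {G : Type*} [NormedAddCommGroup G]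
  {Ω : Set (Euc k)} {gap : ℕ → Set (Euc k)} {δ : ℕ → ℝ} {p ρ B c : ℝ} {f : ℕ → Euc k → G}

/-- Splits a term with decay `ρ ^ n * ρ ^ n` in two: one `ρ ^ n` becomes the weight in
`ENNReal.tsum_mul_rpow_le`, the other makes the `p`-th powers summable. The case `a = 1` covers the
estimates off the gaps. -/
theorem enorm_le_of_norm_mul_rpow_le {g : G} {a β d : ℝ} (ha : 0 < a) (hρ : 0 ≤ ρ)
    {n : ℕ} (h : ‖g‖ * a ^ β ≤ B * ρ ^ n * ρ ^ n * d) (hd : 0 ≤ d) :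
    ‖g‖ₑ ≤ ENNReal.ofReal (ρ ^ n) * (ENNReal.ofReal (B * ρ ^ n / a ^ β) * ENNReal.ofReal d) := by
  have hpos : 0 < a ^ β := Real.rpow_pos_of_pos ha β
  have hn : 0 ≤ ρ ^ n := pow_nonneg hρ n
  rw [← ENNReal.ofReal_mul' hd, ← ENNReal.ofReal_mul hn, ← ofReal_norm]
  apply ENNReal.ofReal_le_ofReal
  rw [← le_div_iff₀ hpos] at h
  refine h.trans (le_of_eq ?_)
  ring

/-- The `p`-th power of `δ n ^ (-1 / p)` is exactly compensated by the gap volume, of order `δ n`; a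
geometric series remains. -/
theorem tsum_weight_rpow_mul_volume_lt_top (hp : 0 < p) (hρ0 : 0 < ρ) (hρ1 : ρ < 1)
    (hB : 0 ≤ B) (hδ : ∀ n, 0 < δ n)
    (hgap : ∀ n, volume (gap n ∩ Ω) ≤ ENNReal.ofReal (c * δ n)) :
    ∑' n, ENNReal.ofReal (B * ρ ^ n / δ n ^ (1 / p)) ^ p * volume (gap n ∩ Ω) < ∞ := by
  have hsum : Summable fun n : ℕ => B ^ p * c * (ρ ^ p) ^ n :=
    (summable_geometric_of_lt_one (by positivity) (Real.rpow_lt_one hρ0.le hρ1 hp)).mul_left _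
  refine lt_of_le_of_lt (ENNReal.tsum_le_tsum fun n => ?_) hsum.tsum_ofReal_lt_top
  have h1 : (0 : ℝ) < δ n ^ (1 / p) := Real.rpow_pos_of_pos (hδ n) _
  have h2 : 0 ≤ B * ρ ^ n := by positivity
  calc _ ≤ ENNReal.ofReal ((B * ρ ^ n / δ n ^ (1 / p)) ^ p) * ENNReal.ofReal (c * δ n) := by
        rw [ENNReal.ofReal_rpow_of_nonneg (by positivity) hp.le]
        gcongr; exact hgap n
    _ = ENNReal.ofReal (B ^ p * c * (ρ ^ p) ^ n) := by
        rw [← ENNReal.ofReal_mul (by positivity)]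
        congr 1
        rw [Real.div_rpow h2 h1.le, ← Real.rpow_mul (hδ n).le, one_div_mul_cancel hp.ne',
          Real.rpow_one, Real.mul_rpow hB (by positivity), ← Real.rpow_natCast,
          ← Real.rpow_natCast, ← Real.rpow_mul hρ0.le, ← Real.rpow_mul hρ0.le, mul_comm p]
        have := (hδ n).ne'
        field_simp

theorem tsum_weight_rpow_lt_top (hp : 0 < p) (hρ0 : 0 < ρ) (hρ1 : ρ < 1) (hB : 0 ≤ B) :
    ∑' n : ℕ, ENNReal.ofReal (B * ρ ^ n) ^ p < ∞ := by
  have hsum : Summable fun n : ℕ => B ^ p * (ρ ^ p) ^ n :=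
    (summable_geometric_of_lt_one (by positivity) (Real.rpow_lt_one hρ0.le hρ1 hp)).mul_left _
  refine lt_of_le_of_lt (ENNReal.tsum_le_tsum fun n => ?_) hsum.tsum_ofReal_lt_top
  rw [ENNReal.ofReal_rpow_of_nonneg (by positivity) hp.le, Real.mul_rpow hB (by positivity),
    ← Real.rpow_natCast, ← Real.rpow_natCast, ← Real.rpow_mul hρ0.le, ← Real.rpow_mul hρ0.le,
    mul_comm p]

theorem tsum_ofReal_pow_rpow_lt_top (hρ0 : 0 < ρ) (hρ1 : ρ < 1) (hp : 0 < p) :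
    (∑' n : ℕ, ENNReal.ofReal (ρ ^ n)) ^ p < ∞ :=
  ENNReal.rpow_lt_top_of_nonneg hp.le
    (summable_geometric_of_lt_one hρ0.le hρ1).tsum_ofReal_lt_top.ne

open Classical in
/-- A series whose terms are small off small sets has a finite `Lᵖ` norm. -/
theorem lintegral_tsum_enorm_rpow_lt_top (hp : 0 < p) (hρ0 : 0 < ρ) (hρ1 : ρ < 1)
    (hB : 0 ≤ B) (hΩ : volume Ω < ∞)
    (hδ : ∀ n, 0 < δ n) (hgapm : ∀ n, MeasurableSet (gap n))
    (hgap : ∀ n, volume (gap n ∩ Ω) ≤ ENNReal.ofReal (c * δ n))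
    (hf : ∀ n x, ‖f n x‖ * δ n ^ (1 / p) ≤ B * ρ ^ n * ρ ^ n)
    (hf' : ∀ n x, x ∉ gap n → ‖f n x‖ ≤ B * ρ ^ n * ρ ^ n) :
    ∫⁻ x in Ω, (∑' n, ‖f n x‖ₑ) ^ p < ∞ := by
  set h : ℕ → ℝ≥0∞ := fun n => ENNReal.ofReal (B * ρ ^ n / δ n ^ (1 / p)) with hh
  set h' : ℕ → ℝ≥0∞ := fun n => ENNReal.ofReal (B * ρ ^ n) with hh'
  have hpt : ∀ x, (∑' n, ‖f n x‖ₑ) ^ p ≤ (∑' n : ℕ, ENNReal.ofReal (ρ ^ n)) ^ p *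
      ∑' n, (h n ^ p * (gap n).indicator 1 x + h' n ^ p) := fun x => by
    calc (∑' n, ‖f n x‖ₑ) ^ p ≤ (∑' n, ENNReal.ofReal (ρ ^ n) *
          (if x ∈ gap n then h n else h' n)) ^ p := by
          gcongr with n
          split_ifs with hx
          · simpa using enorm_le_of_norm_mul_rpow_le (d := 1) (hδ n) hρ0.le
              (by simpa using hf n x) zero_le_one
          · simpa using enorm_le_of_norm_mul_rpow_le (d := 1) (β := 1) one_pos hρ0.le
              (by simpa using hf' n x hx) zero_le_one
      _ ≤ _ := by
          refine (ENNReal.tsum_mul_rpow_le _ _ hp).trans ?_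
          gcongr with n
          split_ifs with hx
          · simp [hx]
          · simp
  have hm : ∀ n, Measurable ((gap n).indicator (1 : Euc k → ℝ≥0∞)) := fun n =>
    measurable_one.indicator (hgapm n)
  have hm' : ∀ n, Measurable fun x => h n ^ p * (gap n).indicator (1 : Euc k → ℝ≥0∞) x + h' n ^ p :=
    fun n => ((hm n).const_mul _).add_const _
  refine lt_of_le_of_lt (lintegral_mono hpt) ?_
  rw [lintegral_const_mul _ (Measurable.tsum hm'), lintegral_tsum fun n => (hm' n).aemeasurable]
  refine ENNReal.mul_lt_top (tsum_ofReal_pow_rpow_lt_top hρ0 hρ1 hp) ?_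
  have e : ∀ n, ∫⁻ x in Ω, (h n ^ p * (gap n).indicator 1 x + h' n ^ p) =
      h n ^ p * volume (gap n ∩ Ω) + h' n ^ p * volume Ω := fun n => by
    rw [lintegral_add_right _ measurable_const, lintegral_const_mul _ (hm n),
      lintegral_indicator_one (hgapm n), Measure.restrict_apply (hgapm n), setLIntegral_const]
  simp_rw [e]
  rw [ENNReal.tsum_add, ENNReal.tsum_mul_right]
  exact ENNReal.add_lt_top.2 ⟨tsum_weight_rpow_mul_volume_lt_top hp hρ0 hρ1 hB hδ hgap,
    ENNReal.mul_lt_top (tsum_weight_rpow_lt_top hp hρ0 hρ1 hB) hΩ⟩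

theorem enorm_sub_le_tsum_enorm_sub {f : ℕ → G} {g : ℕ → G} {a b : G} (hf : HasSum f a)
    (hg : HasSum g b) : ‖a - b‖ₑ ≤ ∑' n, ‖f n - g n‖ₑ := by
  rw [← (hf.sub hg).tsum_eq]
  exact enorm_tsum_le_tsum_enorm

open Classical in
/-- A series whose terms have small Hölder constants off small sets has a finite Gagliardo
energy. -/
theorem gagliardoEnergy_tsum_lt_top {s θ : ℝ} (hp : 0 < p) (hρ0 : 0 < ρ) (hρ1 : ρ < 1)
    (hB : 0 ≤ B) (hsθ : s < θ)
    (hΩ : MeasurableSet Ω) (hΩb : Bornology.IsBounded Ω)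
    (hδ : ∀ n, 0 < δ n) (hgapm : ∀ n, MeasurableSet (gap n))
    (hgap : ∀ n, volume (gap n ∩ Ω) ≤ ENNReal.ofReal (c * δ n))
    (hf : ∀ n x y, ‖f n x - f n y‖ * δ n ^ (1 / p) ≤ B * ρ ^ n * ρ ^ n * ‖x - y‖ ^ θ)
    (hf' : ∀ n x y, x ∉ gap n → y ∉ gap n →
      ‖f n x - f n y‖ ≤ B * ρ ^ n * ρ ^ n * ‖x - y‖ ^ θ) {v : Euc k → G}
    (hv : ∀ᵐ x ∂(volume.restrict Ω), HasSum (fun n => f n x) (v x)) (hθ : 0 ≤ θ) :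
    gagliardoEnergy s p Ω v < ∞ := by
  set h : ℕ → ℝ≥0∞ := fun n => ENNReal.ofReal (B * ρ ^ n / δ n ^ (1 / p)) with hh
  set h' : ℕ → ℝ≥0∞ := fun n => ENNReal.ofReal (B * ρ ^ n) with hh'
  set W := (∑' n : ℕ, ENNReal.ofReal (ρ ^ n)) ^ p with hW
  have hWt : W < ∞ := tsum_ofReal_pow_rpow_lt_top hρ0 hρ1 hp
  refine gagliardoEnergy_lt_top_of_le (θ := θ) (A := gap) (h0 := W * ∑' n, h' n ^ p)
    (h := fun n => W * h n ^ p) hp hsθ hΩ hΩb hgapm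
    (ENNReal.mul_lt_top hWt (tsum_weight_rpow_lt_top hp hρ0 hρ1 hB)) ?_ ?_
  · simp_rw [mul_assoc]
    rw [ENNReal.tsum_mul_left]
    exact ENNReal.mul_lt_top hWt (tsum_weight_rpow_mul_volume_lt_top hp hρ0 hρ1 hB hδ hgap)
  · filter_upwards [hv] with x hx
    filter_upwards [hv] with y hy
    have hd : ENNReal.ofReal (‖x - y‖ ^ θ) = ‖x - y‖ₑ ^ θ := by
      rw [← ENNReal.ofReal_rpow_of_nonneg (norm_nonneg _) hθ, ofReal_norm]
    have hnn : 0 ≤ ‖x - y‖ ^ θ := Real.rpow_nonneg (norm_nonneg _) _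
    calc ‖v x - v y‖ₑ ^ p ≤ (∑' n, ‖f n x - f n y‖ₑ) ^ p := by
          gcongr; exact enorm_sub_le_tsum_enorm_sub hx hy
      -- Pairs meeting the `n`-th gap pay the large constant `h n`, all other pairs the summable
      -- constant `h' n`.
      _ ≤ (∑' n, ENNReal.ofReal (ρ ^ n) *
          ((if x ∈ gap n ∨ y ∈ gap n then h n else h' n) * ‖x - y‖ₑ ^ θ)) ^ p := by
          gcongr with n
          rw [← hd]
          split_ifs with hxy
          · exact enorm_le_of_norm_mul_rpow_le (hδ n) hρ0.le (hf n x y) hnn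
          · push Not at hxy
            simpa using enorm_le_of_norm_mul_rpow_le (a := 1) (β := 1) one_pos hρ0.le
              (by simpa using hf' n x y hxy.1 hxy.2) hnn
      _ ≤ W * ∑' n, (h' n ^ p + h n ^ p * ((gap n).indicator 1 x + (gap n).indicator 1 y)) *
            ‖x - y‖ₑ ^ (θ * p) := by
          refine (ENNReal.tsum_mul_rpow_le _ _ hp).trans ?_
          gcongr with n
          rw [ENNReal.mul_rpow_of_nonneg _ _ hp.le, ← ENNReal.rpow_mul]
          gcongr
          split_ifs with hxy
          · refine le_trans ?_ le_add_self
            rcases hxy with hxy | hxy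
            · calc h n ^ p = h n ^ p * (1 + 0) := by simp
                _ ≤ _ := by gcongr <;> simp [hxy]
            · calc h n ^ p = h n ^ p * (0 + 1) := by simp
                _ ≤ _ := by gcongr <;> simp [hxy]
          · exact le_self_add
      _ = _ := by
          rw [ENNReal.tsum_mul_right, ENNReal.tsum_add, ← mul_assoc, mul_add,
            ← ENNReal.tsum_mul_left (a := W) (f := fun n => h n ^ p * _)]
          simp_rw [mul_assoc]

end Series

/-! ### Layers of the gaps and the fractional perimeter -/

/-- The points at relative distance between `δ (1 - 2 ^ (-l))` and `δ (1 - 2 ^ (-(l + 1)))` from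
the faces of the grid of mesh `r`. -/
def gridLayer (k : ℕ) (r δ : ℝ) (l : ℕ) : Set (Euc k) :=
  {y | ∃ i, δ * (1 - (1 / 2) ^ l) ≤ distInt (y i / r) ∧
    distInt (y i / r) < δ * (1 - (1 / 2) ^ (l + 1))}

theorem measurableSet_gridLayer (k : ℕ) (r δ : ℝ) (l : ℕ) : MeasurableSet (gridLayer k r δ l) := by
  have hm : ∀ i, Measurable fun y : Euc k => distInt (y i / r) := fun i =>
    (continuous_distInt.comp (by fun_prop)).measurable
  simp only [gridLayer, Set.ofPred_exists]
  exact MeasurableSet.iUnion fun i => (measurableSet_le measurable_const (hm i)).inter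
    (measurableSet_lt (hm i) measurable_const)

theorem exists_mem_gridLayer {k : ℕ} {r δ : ℝ} (hr : 0 < r) (hδ : 0 < δ) {x y : Euc k}
    (hx : x ∈ gridCore k r δ) (hy : y ∉ gridCore k r δ) :
    ∃ l, y ∈ gridLayer k r δ l ∧ r * (δ * (1 / 2) ^ (l + 1)) ≤ ‖x - y‖ := by
  simp only [gridCore, mem_ofPred_eq, not_forall, not_le] at hy
  obtain ⟨i, hi⟩ := hy
  have hn := distInt_nonneg (y i / r)
  -- The layer is the dyadic scale of the relative depth `(δ - distInt) / δ`, which lies in `(0,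
  -- 1]`.
  obtain ⟨l, hl1, hl2⟩ := exists_nat_pow_near_of_lt_one (x := (δ - distInt (y i / r)) / δ)
    (y := 1 / 2) (div_pos (by linarith) hδ) ((div_le_one hδ).2 (by linarith)) (by norm_num)
    (by norm_num)
  rw [lt_div_iff₀ hδ] at hl1
  rw [div_le_iff₀ hδ] at hl2
  refine ⟨l, ⟨i, by linarith, by linarith⟩, ?_⟩
  have h1 := distInt_sub_distInt_le (x i / r) (y i / r)
  have h2 := hx i
  rw [← sub_div, abs_div, abs_of_pos hr] at h1
  have h3 : δ * (1 / 2) ^ (l + 1) ≤ |x i - y i| / r := by linarith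
  rw [le_div_iff₀ hr] at h3
  calc _ ≤ |x i - y i| := by linarith
    _ ≤ ‖x - y‖ := PiLp.norm_apply_le (x - y) i

/-- Fractional perimeter bound for a set cut out by grid cores. -/
theorem gagliardoEnergy_indicator_lt_top {k : ℕ} {Ω K : Set (Euc k)} {r δ : ℕ → ℝ} {s θ d C : ℝ}
    (hΩ : MeasurableSet Ω) (hΩb : Bornology.IsBounded Ω) (hsθ : s < θ) (hθ0 : 0 ≤ θ) (hθ1 : θ < 1)
    (hr : ∀ n, 0 < r n) (hδ : ∀ n, 0 < δ n) (hd : 0 < d)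
    (hvol : ∀ n l, volume (gridLayer k (r n) (δ n) l ∩ Ω) ≤
      ENNReal.ofReal (C * (δ n * (1 / 2) ^ (l + 1))))
    (hsum : Summable fun n => δ n ^ (1 - θ) * r n ^ (-θ))
    (hK : ∀ x ∈ K, ∀ y, y ∉ K → d ≤ ‖x - y‖ ∨
      ∃ n, x ∈ gridCore k (r n) (δ n) ∧ y ∉ gridCore k (r n) (δ n)) :
    gagliardoEnergy s 1 Ω (K.indicator fun _ => (1 : ℝ)) < ∞ := by
  set e : ℕ × ℕ → ℝ := fun i => r i.1 * (δ i.1 * (1 / 2) ^ (i.2 + 1)) with he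
  have hepos : ∀ i, 0 < e i := fun i => by
    have := hr i.1; have := hδ i.1; simp only [he]; positivity
  have key : ∀ (a : ℝ) (x y : Euc k), 0 < a → a ≤ ‖x - y‖ →
      1 ≤ ENNReal.ofReal (a ^ (-θ)) * ‖x - y‖ₑ ^ θ := fun a x y ha hxy => by
    rw [← ofReal_norm, ENNReal.ofReal_rpow_of_nonneg (norm_nonneg _) hθ0,
      ← ENNReal.ofReal_mul (by positivity), ENNReal.one_le_ofReal, Real.rpow_neg ha.le,
      inv_mul_eq_div, one_le_div (by positivity)]
    gcongr
  refine gagliardoEnergy_lt_top_of_le (θ := θ) (ι := ℕ × ℕ)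
    (A := fun i => gridLayer k (r i.1) (δ i.1) i.2) (h0 := ENNReal.ofReal (d ^ (-θ)))
    (h := fun i => ENNReal.ofReal (e i ^ (-θ))) one_pos hsθ hΩ hΩb
    (fun i => measurableSet_gridLayer _ _ _ _) ENNReal.ofReal_lt_top ?_ ?_
  -- A layer of depth `l` has volume of order `δ * 2 ^ (-(l + 1))` and Hölder constant `(r * δ * 2 ^
  -- (-(l + 1))) ^ (-θ)`. The double series factors into a sum over levels and a geometric sum over
  -- `l` that converges since `θ < 1`.
  · have hgeo : Summable fun l : ℕ => C * (((1 : ℝ) / 2) ^ (l + 1)) ^ (1 - θ) := by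
      have h1 : ((1 : ℝ) / 2) ^ (1 - θ) < 1 :=
        Real.rpow_lt_one (by norm_num) (by norm_num) (by linarith)
      have h2 := ((summable_geometric_of_lt_one (by positivity) h1).mul_left
        ((1 / 2 : ℝ) ^ (1 - θ))).mul_left C
      refine h2.congr fun l => ?_
      rw [← pow_succ', ← Real.rpow_natCast, ← Real.rpow_natCast, ← Real.rpow_mul (by norm_num),
        ← Real.rpow_mul (by norm_num), mul_comm (1 - θ)]
    have hprod := summable_mul_of_summable_norm hsum.norm hgeo.norm
    refine lt_of_le_of_lt (ENNReal.tsum_le_tsum fun i => ?_) hprod.tsum_ofReal_lt_top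
    calc _ ≤ ENNReal.ofReal (e i ^ (-θ)) * ENNReal.ofReal (C * (δ i.1 * (1 / 2) ^ (i.2 + 1))) := by
          gcongr; exact hvol _ _
      _ = _ := by
          have h1 := hr i.1
          have h2 := hδ i.1
          have h3 : (0 : ℝ) < (1 / 2) ^ (i.2 + 1) := by positivity
          have h4 := hepos i
          rw [← ENNReal.ofReal_mul (by positivity)]
          congr 1
          simp only [he]
          rw [Real.mul_rpow h1.le (by positivity), sub_eq_add_neg, Real.rpow_add h2,
            Real.rpow_add h3, Real.rpow_one, Real.rpow_one, Real.mul_rpow h2.le h3.le]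
          ring
  · refine Filter.Eventually.of_forall fun x => Filter.Eventually.of_forall fun y => ?_
    rw [mul_one, ENNReal.rpow_one]
    have half : ∀ x ∈ K, ∀ y, y ∉ K → 1 ≤ (ENNReal.ofReal (d ^ (-θ)) +
        ∑' i : ℕ × ℕ, ENNReal.ofReal (e i ^ (-θ)) *
          (gridLayer k (r i.1) (δ i.1) i.2).indicator 1 y) * ‖x - y‖ₑ ^ θ := by
      intro x hx y hy
      rcases hK x hx y hy with h | ⟨n, hn1, hn2⟩
      · refine (key d x y hd h).trans ?_
        gcongr; exact le_self_add
      · obtain ⟨l, hl1, hl2⟩ := exists_mem_gridLayer (hr n) (hδ n) hn1 hn2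
        refine (key (e (n, l)) x y (hepos _) hl2).trans ?_
        gcongr
        refine le_trans ?_ le_add_self
        refine le_trans ?_ (ENNReal.le_tsum (n, l))
        simp [hl1]
    by_cases hx : x ∈ K <;> by_cases hy : y ∈ K
    · simp [hx, hy]
    · simp only [indicator_of_mem hx, indicator_of_notMem hy, sub_zero, enorm_one]
      refine (half x hx y hy).trans ?_
      gcongr; exact le_add_self
    · simp only [indicator_of_mem hy, indicator_of_notMem hx, zero_sub, enorm_neg, enorm_one]
      refine (half y hy x hx).trans ?_
      rw [enorm_sub_rev y x]
      gcongr; exact le_self_add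
    · simp [hx, hy]

/-! ### Gap widths and the choice of exponents -/

/-- Polynomial factors are absorbed by geometric decay. -/
theorem exists_add_one_rpow_mul_pow_le (b : ℝ) {σ : ℝ} (h0 : 0 < σ) (h1 : σ < 1) :
    ∃ B : ℝ, 0 ≤ B ∧ ∀ n : ℕ, ((n : ℝ) + 1) ^ b * σ ^ n ≤ B := by
  obtain ⟨N, hN⟩ := exists_nat_ge b
  have ht := tendsto_pow_const_mul_const_pow_of_abs_lt_one N (r := σ) (by rwa [abs_of_pos h0])
  obtain ⟨B, hB⟩ := ht.bddAbove_range
  have hB' : ∀ n : ℕ, (n : ℝ) ^ N * σ ^ n ≤ B := fun n => hB ⟨n, rfl⟩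
  have hB0 : 0 ≤ B := le_trans (by positivity) (hB' 1)
  refine ⟨B / σ, by positivity, fun n => ?_⟩
  rw [le_div_iff₀ h0]
  calc ((n : ℝ) + 1) ^ b * σ ^ n * σ ≤ ((n : ℝ) + 1) ^ (N : ℝ) * σ ^ n * σ := by
        gcongr
        linarith [Nat.cast_nonneg (α := ℝ) n]
    _ = ((n + 1 : ℕ) : ℝ) ^ N * σ ^ (n + 1) := by
        rw [Real.rpow_natCast]; push_cast; ring
    _ ≤ B := hB' (n + 1)

/-- The relative gap widths. -/
noncomputable def gapWidth (c τ : ℝ) (n : ℕ) : ℝ := c * (1 / 2) ^ (τ * n) / ((n : ℝ) + 1) ^ (2 : ℝ)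

theorem gapWidth_pos {c : ℝ} (hc : 0 < c) (τ : ℝ) (n : ℕ) : 0 < gapWidth c τ n := by
  unfold gapWidth; positivity

theorem gapWidth_le {c τ : ℝ} (hc : 0 < c) (hτ : 0 ≤ τ) (n : ℕ) :
    gapWidth c τ n ≤ c * (1 / ((n : ℝ) + 1) ^ (2 : ℝ)) := by
  unfold gapWidth
  rw [mul_div_assoc]
  gcongr
  exact Real.rpow_le_one (by norm_num) (by norm_num) (by positivity)

theorem gapWidth_le_self {c τ : ℝ} (hc : 0 < c) (hτ : 0 ≤ τ) (n : ℕ) : gapWidth c τ n ≤ c := by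
  refine (gapWidth_le hc hτ n).trans (mul_le_of_le_one_right hc.le ?_)
  rw [div_le_one (by positivity)]
  exact Real.one_le_rpow (by linarith [Nat.cast_nonneg (α := ℝ) n]) (by norm_num)

theorem summable_one_div_add_one_rpow : Summable fun n : ℕ => 1 / ((n : ℝ) + 1) ^ (2 : ℝ) := by
  have h := (summable_nat_add_iff 1).2 (Real.summable_one_div_nat_rpow.2 (one_lt_two (α := ℝ)))
  simpa using h

/-- Up to a constant the product is `(n + 1) ^ (2 b) * 2 ^ (-κ n)` with `κ = a - τ b > 0`. With `ρ =
2 ^ (-κ / 4)` there are four factors `ρ ^ n`: two absorb the polynomial and two are kept for the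
series lemmas. -/
theorem exists_rpow_mul_gapWidth_rpow_le {r₀ c τ a b : ℝ} (hr₀ : 0 < r₀) (hc : 0 < c)
    (hab : τ * b < a) : ∃ B ρ : ℝ, 0 ≤ B ∧ 0 < ρ ∧ ρ < 1 ∧
      ∀ n : ℕ, (r₀ / 2 ^ n) ^ a * gapWidth c τ n ^ (-b) ≤ B * ρ ^ n * ρ ^ n := by
  set κ := a - τ * b with hκ
  have hκ0 : 0 < κ := sub_pos.2 hab
  set ρ : ℝ := (1 / 2) ^ (κ / 4) with hρ
  have hρ0 : 0 < ρ := by positivity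
  have hρ1 : ρ < 1 := Real.rpow_lt_one (by norm_num) (by norm_num) (by positivity)
  obtain ⟨B, hB0, hB⟩ := exists_add_one_rpow_mul_pow_le (2 * b) (σ := ρ * ρ) (by positivity)
    (by nlinarith)
  refine ⟨r₀ ^ a * c ^ (-b) * B, ρ, by positivity, hρ0, hρ1, fun n => ?_⟩
  have hn : (0 : ℝ) < (n : ℝ) + 1 := by positivity
  have e : (r₀ / 2 ^ n) ^ a * gapWidth c τ n ^ (-b) = r₀ ^ a * c ^ (-b) *
      (((n : ℝ) + 1) ^ (2 * b) * (ρ * ρ) ^ n) * ρ ^ n * ρ ^ n := by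
    have h1 : (r₀ / 2 ^ n) ^ a = r₀ ^ a * (1 / 2) ^ (n * a) := by
      rw [div_eq_mul_one_div, ← one_div_pow, Real.mul_rpow hr₀.le (by positivity),
        ← Real.rpow_natCast, ← Real.rpow_mul (by norm_num)]
    have h2 : gapWidth c τ n ^ (-b) =
        c ^ (-b) * (1 / 2) ^ (τ * n * -b) * ((n : ℝ) + 1) ^ (2 * b) := by
      rw [gapWidth, Real.div_rpow (by positivity) (by positivity),
        Real.mul_rpow hc.le (by positivity), ← Real.rpow_mul (by norm_num), ← Real.rpow_mul hn.le,
        mul_neg (2 : ℝ) b, Real.rpow_neg hn.le, div_inv_eq_mul]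
    have h3 : (ρ * ρ) ^ n * ρ ^ n * ρ ^ n = (1 / 2) ^ (n * a) * (1 / 2) ^ (τ * n * -b) := by
      rw [← mul_pow, ← mul_pow, hρ, ← Real.rpow_add (by norm_num), ← Real.rpow_add (by norm_num),
        ← Real.rpow_add (by norm_num), ← Real.rpow_add (by norm_num), ← Real.rpow_natCast,
        ← Real.rpow_mul (by norm_num)]
      congr 1
      rw [hκ]; ring
    rw [h1, h2]
    linear_combination (-(r₀ ^ a * c ^ (-b) * ((n : ℝ) + 1) ^ (2 * b))) * h3
  rw [e]
  have := hB n
  gcongr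

theorem summable_rpow_mul_gapWidth_rpow {r₀ c τ a b : ℝ} (hr₀ : 0 < r₀) (hc : 0 < c)
    (hab : τ * b < a) :
    Summable fun n : ℕ => (r₀ / 2 ^ n) ^ a * gapWidth c τ n ^ (-b) := by
  obtain ⟨B, ρ, hB, hρ0, hρ1, h⟩ := exists_rpow_mul_gapWidth_rpow_le hr₀ hc hab
  refine Summable.of_nonneg_of_le (fun n => ?_) h ?_
  · have := gapWidth_pos hc τ n
    positivity
  · have : Summable fun n : ℕ => B * (ρ * ρ) ^ n :=
      (summable_geometric_of_lt_one (by positivity) (by nlinarith)).mul_left B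
    refine this.congr fun n => ?_
    rw [mul_pow]; ring

/-- The choice of exponents: `τ` governs the gap widths. -/
theorem exists_exponents {α s ι : ℝ} (hα1 : α < 1) (hs0 : 0 ≤ s)
    (hι1 : ι ≤ 1) (hαs : α < 1 - (2 - ι) * s) (hα0 : 0 ≤ α) :
    ∃ τ θ θ' : ℝ, 0 ≤ τ ∧ α < θ ∧ θ < 1 ∧ τ * (1 + θ - ι) < 1 - θ ∧ (s = 0 → τ = 0) ∧
      (0 < s → s < θ' ∧ θ' < 1 ∧ θ' < τ * (1 - θ')) ∧ (s < 1 / 2 → τ < 1) := by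
  rcases hs0.eq_or_lt with rfl | hs
  · exact ⟨0, (α + 1) / 2, 0, le_rfl, by linarith, by linarith, by linarith, fun _ => rfl,
      fun h => absurd h (lt_irrefl _), fun _ => one_pos⟩
  · have hs1 : s < 1 := by nlinarith
    -- The critical value, where `s = τ₀ * (1 - s)`; any larger `τ` leaves room for some `θ' > s`.
    set τ₀ := s / (1 - s) with hτ₀
    have h1s : 0 < 1 - s := by linarith
    have hτ₀e : τ₀ * (1 - s) = s := by rw [hτ₀]; field_simp
    have hτ₀0 : 0 ≤ τ₀ := by positivity
    have hτ₀1 : s < 1 / 2 → τ₀ < 1 := fun h => by rw [hτ₀, div_lt_one h1s]; linarith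
    -- Multiplied by `1 - s`, the condition at the critical values becomes `α < 1 - (2 - ι) * s`.
    -- Being strict, it survives increasing `τ` and `θ` by a small `e`.
    have hpos : 0 < (1 - (α + 0)) - (τ₀ + 0) * (1 + (α + 0) - ι) := by
      have : 0 < ((1 - α) - τ₀ * (1 + α - ι)) * (1 - s) := by
        have e : ((1 - α) - τ₀ * (1 + α - ι)) * (1 - s) =
            (1 - α) * (1 - s) - (τ₀ * (1 - s)) * (1 + α - ι) := by ring
        rw [e, hτ₀e]; linarith
      have := pos_of_mul_pos_left this h1s.le
      linarith
    have c1 : ContinuousAt (fun e : ℝ => (1 - (α + e)) - (τ₀ + e) * (1 + (α + e) - ι)) 0 := by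
      fun_prop
    have c2 : ContinuousAt (fun e : ℝ => α + e) 0 := by fun_prop
    have c3 : ContinuousAt (fun e : ℝ => τ₀ + e) 0 := by fun_prop
    have ev1 := c1.eventually_const_lt hpos
    have ev2 := c2.eventually_lt_const (show α + 0 < 1 by linarith)
    have ev3 : ∀ᶠ e : ℝ in nhds 0, s < 1 / 2 → τ₀ + e < 1 := by
      by_cases h : s < 1 / 2
      · filter_upwards [c3.eventually_lt_const (show τ₀ + 0 < 1 by linarith [hτ₀1 h])] with e he _
        exact he
      · exact Filter.Eventually.of_forall fun e h' => absurd h' h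
    have ev := ((ev1.and (ev2.and ev3)).filter_mono (nhdsWithin_le_nhds (s := Ioi (0 : ℝ)))).and
      self_mem_nhdsWithin
    obtain ⟨e, ⟨he1, he2, he3⟩, he0⟩ := ev.exists
    have he0 : 0 < e := he0
    have d1 : ContinuousAt (fun d : ℝ => (τ₀ + e) * (1 - (s + d)) - (s + d)) 0 := by fun_prop
    have d2 : ContinuousAt (fun d : ℝ => s + d) 0 := by fun_prop
    have dv := (((d1.eventually_const_lt (show
      0 < (τ₀ + e) * (1 - (s + 0)) - (s + 0) by nlinarith)).and
        (d2.eventually_lt_const (show s + 0 < 1 by linarith))).filter_mono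
          (nhdsWithin_le_nhds (s := Ioi (0 : ℝ)))).and self_mem_nhdsWithin
    obtain ⟨d, ⟨hd1, hd2⟩, hd0⟩ := dv.exists
    have hd0 : 0 < d := hd0
    exact ⟨τ₀ + e, α + e, s + d, by linarith, by linarith, he2, by linarith,
      fun h => absurd h hs.ne', fun _ => ⟨by linarith, hd2, by linarith⟩, he3⟩

/-! ### Estimates for one level -/

section LevelEstimates

variable {k m : ℕ} {r δ Λ C θ : ℝ} {Φ : Euc k → ℝ} {Φ' : Euc k → Euc k →L[ℝ] ℝ}
  {A : Euc k → Euc k →L[ℝ] Euc m} {b : Euc k → Euc k}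

/-- The constant in the estimates for the corrections of one level. -/
noncomputable def levelConst (k : ℕ) (Λ C : ℝ) : ℝ := C * (2 + 2 * Λ + Λ * k + Λ ^ 2 * k)

theorem two_mul_le_levelConst (hΛ : 0 ≤ Λ) (hC : 0 ≤ C) : 2 * C ≤ levelConst k Λ C := by
  unfold levelConst
  have : 0 ≤ C * (2 * Λ + Λ * k + Λ ^ 2 * k) := by positivity
  linarith

theorem norm_level_le (hr : 0 < r) (hδ : 0 < δ) (hδ1 : δ ≤ 1) (hΛ : 0 ≤ Λ) (hC : 0 ≤ C)
    (hΦ : IsCutoff Φ Φ' (Λ / (δ * r))) (ha : ∀ x, ‖A x‖ ≤ C * r)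
    (hD : ∀ x, A x = 0 ∨ ‖x - b x‖ ≤ k * r) (x : Euc k) :
    ‖cellBumpDeriv Φ Φ' A b x‖ ≤ levelConst k Λ C * (r / δ) := by
  refine (norm_cellBumpDeriv_le hΦ ha (by positivity) hD x).trans ?_
  have e : C * r + Λ / (δ * r) * (C * r * (k * r)) = C * (r * 1) + C * (Λ * k) * (r / δ) := by
    field_simp
  rw [e]
  have h1 : r * 1 ≤ r * (1 / δ) := by gcongr; rwa [one_le_div hδ]
  calc _ ≤ C * (r * (1 / δ)) + C * (Λ * k) * (r / δ) := by gcongr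
    _ = C * (1 + Λ * k) * (r / δ) := by ring
    _ ≤ _ := by
      unfold levelConst
      gcongr ?_ * _
      gcongr C * ?_
      have : 0 ≤ 2 * Λ + Λ ^ 2 * k := by positivity
      linarith

theorem norm_level_sub_le (hr : 0 < r) (hδ : 0 < δ) (hδ1 : δ ≤ 1) (hΛ : 0 ≤ Λ) (hC : 0 ≤ C)
    (hΦ : IsCutoff Φ Φ' (Λ / (δ * r)))
    (hΦ0 : ∀ x, (∃ i, ∃ z : ℤ, x i / r = z) → (Φ x = 0 ∧ Φ' x = 0) ∧ ∀ᶠ y in nhds x, Φ y = 0)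
    (hA : ∀ x y, SameCell r x y → A x = A y) (hb : ∀ x y, SameCell r x y → b x = b y)
    (ha : ∀ x, ‖A x‖ ≤ C * r) (hD : ∀ x, A x = 0 ∨ ‖x - b x‖ ≤ k * r) (x y : Euc k) :
    ‖cellBumpDeriv Φ Φ' A b x - cellBumpDeriv Φ Φ' A b y‖ ≤
      levelConst k Λ C / δ ^ 2 * ‖x - y‖ := by
  refine (norm_cellBumpDeriv_sub_le hΦ hΦ0 hA hb ha (by positivity) hD x y).trans ?_
  gcongr
  have e : 2 * (Λ / (δ * r)) * (C * r) + (Λ / (δ * r)) ^ 2 * (C * r * (k * r)) =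
      (C * (2 * Λ * δ) + C * (Λ ^ 2 * k)) / δ ^ 2 := by
    field_simp
  rw [e]
  gcongr
  unfold levelConst
  have h1 : C * (2 * Λ * δ) ≤ C * (2 * Λ * 1) := by gcongr
  have h2 : 0 ≤ C * (2 + Λ * k) := by positivity
  linarith

/-- Interpolates between the size `r / δ` and the Lipschitz constant `1 / δ ^ 2`. -/
theorem norm_level_sub_le_rpow (hr : 0 < r) (hδ : 0 < δ) (hδ1 : δ ≤ 1) (hΛ : 0 ≤ Λ) (hC : 0 ≤ C)
    (hΦ : IsCutoff Φ Φ' (Λ / (δ * r)))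
    (hΦ0 : ∀ x, (∃ i, ∃ z : ℤ, x i / r = z) → (Φ x = 0 ∧ Φ' x = 0) ∧ ∀ᶠ y in nhds x, Φ y = 0)
    (hA : ∀ x y, SameCell r x y → A x = A y) (hb : ∀ x y, SameCell r x y → b x = b y)
    (ha : ∀ x, ‖A x‖ ≤ C * r) (hD : ∀ x, A x = 0 ∨ ‖x - b x‖ ≤ k * r)
    (hθ0 : 0 ≤ θ) (hθ1 : θ ≤ 1) (x y : Euc k) :
    ‖cellBumpDeriv Φ Φ' A b x - cellBumpDeriv Φ Φ' A b y‖ ≤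
      2 * levelConst k Λ C * (r ^ (1 - θ) * δ ^ (-(1 + θ))) * ‖x - y‖ ^ θ := by
  set Q := levelConst k Λ C with hQ
  have hQ0 : 0 ≤ Q := le_trans (by positivity) (two_mul_le_levelConst (k := k) hΛ hC)
  have h1 : ‖cellBumpDeriv Φ Φ' A b x - cellBumpDeriv Φ Φ' A b y‖ ≤ 2 * Q * (r / δ) := by
    refine (norm_sub_le _ _).trans ?_
    have hx := norm_level_le hr hδ hδ1 hΛ hC hΦ ha hD x
    have hy := norm_level_le hr hδ hδ1 hΛ hC hΦ ha hD y
    linarith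
  have h2 : ‖cellBumpDeriv Φ Φ' A b x - cellBumpDeriv Φ Φ' A b y‖ ≤
      2 * Q * (1 / δ ^ 2) * ‖x - y‖ := by
    refine (norm_level_sub_le hr hδ hδ1 hΛ hC hΦ hΦ0 hA hb ha hD x y).trans ?_
    gcongr
    rw [div_eq_mul_one_div]
    gcongr
    linarith
  have h3 := le_rpow_mul_of_le_of_le (norm_nonneg _) (by positivity) (by positivity)
    (norm_nonneg _) hθ0 hθ1 h1 h2
  refine h3.trans (le_of_eq ?_)
  congr 1
  rw [Real.mul_rpow (x := 2 * Q) (by positivity) (by positivity),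
    Real.mul_rpow (x := 2 * Q) (by positivity) (by positivity), Real.div_rpow hr.le hδ.le]
  have e1 : (2 * Q) ^ (1 - θ) * (2 * Q) ^ θ = 2 * Q := by
    rw [← Real.rpow_add_of_nonneg (by positivity) (by linarith) hθ0]; simp
  have e2 : (1 / δ ^ 2) ^ θ = δ ^ (-(2 * θ)) := by
    rw [one_div, Real.inv_rpow (by positivity), ← Real.rpow_natCast, ← Real.rpow_mul hδ.le,
      Real.rpow_neg hδ.le]
    norm_num
  have e3 : δ ^ (-(1 + θ)) = (δ ^ (1 - θ))⁻¹ * δ ^ (-(2 * θ)) := by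
    rw [← Real.rpow_neg hδ.le, ← Real.rpow_add hδ]; congr 1; ring
  rw [e2, e3]
  linear_combination (r ^ (1 - θ) / δ ^ (1 - θ) * δ ^ (-(2 * θ))) * e1

theorem cellBumpDeriv_of_mem_core (hΦ1 : ∀ x ∈ gridCore k r δ, Φ x = 1 ∧ Φ' x = 0) {x : Euc k}
    (hx : x ∈ gridCore k r δ) : cellBumpDeriv Φ Φ' A b x = A x := by
  rw [cellBumpDeriv, (hΦ1 x hx).1, (hΦ1 x hx).2]; ext; simp

/-- On the core the derivative is the cellwise constant `A`: it does not vary within a cell, and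
different cells are `δ * r` apart. This saves a full factor `δ` over the general estimate, so the
gap volume need not compensate for it. -/
theorem norm_core_sub_le_rpow (hr : 0 < r) (hδ : 0 < δ) (hC : 0 ≤ C)
    (hΦ1 : ∀ x ∈ gridCore k r δ, Φ x = 1 ∧ Φ' x = 0)
    (hA : ∀ x y, SameCell r x y → A x = A y)
    (ha : ∀ x, ‖A x‖ ≤ C * r) (hθ0 : 0 ≤ θ) {x y : Euc k}
    (hx : x ∈ gridCore k r δ) (hy : y ∈ gridCore k r δ) :
    ‖cellBumpDeriv Φ Φ' A b x - cellBumpDeriv Φ Φ' A b y‖ ≤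
      2 * C * (r ^ (1 - θ) * δ ^ (-θ)) * ‖x - y‖ ^ θ := by
  rw [cellBumpDeriv_of_mem_core hΦ1 hx, cellBumpDeriv_of_mem_core hΦ1 hy]
  by_cases h : SameCell r x y
  · rw [hA x y h, sub_self, norm_zero]; positivity
  · have hd := le_norm_sub_of_not_sameCell hr hx h
    have h1 : ‖A x - A y‖ ≤ 2 * C * r := (norm_sub_le _ _).trans (by linarith [ha x, ha y])
    calc _ ≤ 2 * C * (r ^ (1 - θ) * δ ^ (-θ)) * (δ * r) ^ θ := by
          refine h1.trans (le_of_eq ?_)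
          rw [Real.mul_rpow hδ.le hr.le, sub_eq_add_neg, Real.rpow_add hr, Real.rpow_one,
            Real.rpow_neg hr.le, Real.rpow_neg hδ.le]
          have h1 : δ ^ θ ≠ 0 := (Real.rpow_pos_of_pos hδ _).ne'
          have h2 : r ^ θ ≠ 0 := (Real.rpow_pos_of_pos hr _).ne'
          field_simp
      _ ≤ _ := by gcongr

end LevelEstimates

/-! ### Existence of the correction series -/

/-- A series of `C¹` corrections `w n` with derivatives `f n`, at the scales `r₀ / 2 ^ n` with
relative gaps `gapWidth c τ n`, whose sum solves `Du = F (x, u)` on `K`. -/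
structure IsCorrectionSeries {k m : ℕ} (Ω : Set (Euc k)) (F : Euc k × Euc m → (Euc k →L[ℝ] Euc m))
    (η τ c r₀ Q V : ℝ) (K S : Set (Euc k)) (w : ℕ → Euc k → Euc m)
    (f : ℕ → Euc k → Euc k →L[ℝ] Euc m) : Prop where
  c_pos : 0 < c
  c_le : c ≤ 1
  tau_nonneg : 0 ≤ τ
  mesh_pos : 0 < r₀
  mesh_le : r₀ ≤ 1
  Q_nonneg : 0 ≤ Q
  isCompact : IsCompact S
  subset : S ⊆ Ω
  hasFDerivAt : ∀ n x, HasFDerivAt (w n) (f n x) x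
  eq_zero : ∀ n x, x ∉ S → w n x = 0
  norm_le : ∀ n x, ‖w n x‖ ≤ η / 2 * (1 / 2) ^ n
  norm_deriv_le : ∀ n x, ‖f n x‖ ≤ Q * (r₀ / 2 ^ n / gapWidth c τ n)
  norm_deriv_sub_le : ∀ θ : ℝ, 0 ≤ θ → θ ≤ 1 → ∀ n x y, ‖f n x - f n y‖ ≤
    Q * ((r₀ / 2 ^ n) ^ (1 - θ) * gapWidth c τ n ^ (-(1 + θ))) * ‖x - y‖ ^ θ
  norm_deriv_core_le : ∀ n, ∀ x ∈ gridCore k (r₀ / 2 ^ n) (gapWidth c τ n),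
    ‖f n x‖ ≤ Q * (r₀ / 2 ^ n)
  norm_deriv_core_sub_le : ∀ θ : ℝ, 0 ≤ θ → ∀ n,
    ∀ x ∈ gridCore k (r₀ / 2 ^ n) (gapWidth c τ n),
    ∀ y ∈ gridCore k (r₀ / 2 ^ n) (gapWidth c τ n), ‖f n x - f n y‖ ≤
    Q * ((r₀ / 2 ^ n) ^ (1 - θ) * gapWidth c τ n ^ (-θ)) * ‖x - y‖ ^ θ
  isCompact_K : IsCompact K
  K_subset : K ⊆ Ω
  hasSum_deriv : ∀ x ∈ K, HasSum (fun n => f n x) (F (x, ∑' n, w n x))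
  separated : ∃ d, 0 < d ∧ ∀ x ∈ K, ∀ y, y ∉ K → d ≤ ‖x - y‖ ∨
    ∃ n, x ∈ gridCore k (r₀ / 2 ^ n) (gapWidth c τ n) ∧
      y ∉ gridCore k (r₀ / 2 ^ n) (gapWidth c τ n)
  volume_gap_le : ∀ n, volume ((gridCore k (r₀ / 2 ^ n) (gapWidth c τ n))ᶜ ∩ Ω) ≤
    ENNReal.ofReal (V * gapWidth c τ n)
  volume_layer_le : ∀ n l, volume (gridLayer k (r₀ / 2 ^ n) (gapWidth c τ n) l ∩ Ω) ≤
    ENNReal.ofReal (V * (gapWidth c τ n * (1 / 2) ^ (l + 1)))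

theorem compl_gridCore_subset (k : ℕ) (r δ : ℝ) :
    (gridCore k r δ)ᶜ ⊆ {x : Euc k | ∃ i, 0 ≤ distInt (x i / r) ∧ distInt (x i / r) < δ} := by
  intro x hx
  simp only [gridCore, mem_compl_iff, mem_ofPred_eq, not_forall, not_le] at hx
  obtain ⟨i, hi⟩ := hx
  exact ⟨i, distInt_nonneg _, hi⟩

/-- A limit point lies in the core and is closer than `δ * r` to a core point of `E`, hence in the
same cell. -/
theorem isClosed_saturation_inter_gridCore {k : ℕ} {r δ : ℝ} (hr : 0 < r) (hδ : 0 < δ)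
    {E : Set (Euc k)} (hE : ∀ x ∈ E, ∀ y, SameCell r x y → y ∈ E) :
    IsClosed (E ∩ gridCore k r δ) := by
  refine isClosed_of_closure_subset fun x hx => ?_
  have hxc : x ∈ gridCore k r δ :=
    (isClosed_gridCore k r δ).closure_subset (closure_mono inter_subset_right hx)
  obtain ⟨y, ⟨hyE, hyc⟩, hxy⟩ := Metric.mem_closure_iff.1 hx (δ * r) (by positivity)
  refine ⟨hE y hyE x ?_, hxc⟩
  by_contra h
  have := le_norm_sub_of_not_sameCell hr hyc h
  rw [dist_comm, dist_eq_norm] at hxy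
  linarith

/-- On a compact subset of the domain and for bounded values, a locally Lipschitz field is bounded
and Lipschitz. -/
theorem exists_bounds_of_locallyLipschitzOn {k m : ℕ} {Ω S : Set (Euc k)} {η : ℝ}
    {F : Euc k × Euc m → (Euc k →L[ℝ] Euc m)}
    (hF : LocallyLipschitzOn (Ω ×ˢ (univ : Set (Euc m))) F) (hS : IsCompact S) (hSΩ : S ⊆ Ω) :
    ∃ L M : ℝ, 0 ≤ L ∧ 0 ≤ M ∧ (∀ x ∈ S, ∀ p, ‖p‖ ≤ η → ‖F (x, p)‖ ≤ M) ∧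
      ∀ x ∈ S, ∀ y ∈ S, ∀ p q, ‖p‖ ≤ η → ‖q‖ ≤ η →
        ‖F (x, p) - F (y, q)‖ ≤ L * (‖x - y‖ + ‖p - q‖) := by
  have hc : IsCompact (S ×ˢ Metric.closedBall (0 : Euc m) η) :=
    hS.prod (isCompact_closedBall 0 η)
  have hl : LocallyLipschitzOn (S ×ˢ Metric.closedBall (0 : Euc m) η) F :=
    hF.mono (prod_mono hSΩ (subset_univ _))
  obtain ⟨L, hL⟩ := hl.exists_lipschitzOnWith_of_compact hc
  obtain ⟨M, hM⟩ := hc.exists_bound_of_continuousOn hL.continuousOn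
  have hmem : ∀ x ∈ S, ∀ p : Euc m, ‖p‖ ≤ η → (x, p) ∈ S ×ˢ Metric.closedBall (0 : Euc m) η :=
    fun x hx p hp => ⟨hx, by simpa using hp⟩
  refine ⟨L, max M 0, L.2, le_max_right _ _, fun x hx p hp =>
    (hM _ (hmem x hx p hp)).trans (le_max_left _ _), fun x hx y hy p q hp hq => ?_⟩
  have := hL.dist_le_mul _ (hmem x hx p hp) _ (hmem y hy q hq)
  rw [dist_eq_norm, Prod.dist_eq, dist_eq_norm, dist_eq_norm] at this
  refine this.trans ?_
  gcongr
  exact max_le (le_add_of_nonneg_right (norm_nonneg _)) (le_add_of_nonneg_left (norm_nonneg _))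

theorem exists_isCorrectionSeries {k m : ℕ} {η ε τ : ℝ} (hη : 0 < η) (hε : 0 < ε) (hτ : 0 ≤ τ)
    {Ω : Set (Euc k)} (hΩ : IsOpen Ω) (hΩb : Bornology.IsBounded Ω) (hΩn : Ω.Nonempty)
    {F : Euc k × Euc m → (Euc k →L[ℝ] Euc m)}
    (hF : LocallyLipschitzOn (Ω ×ˢ (univ : Set (Euc m))) F) :
    ∃ c r₀ Q V K S w f, IsCorrectionSeries Ω F η τ c r₀ Q V K S w f ∧
      volume (Ω \ K) ≤ ENNReal.ofReal ε * volume Ω := by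
  have hvt : volume Ω ≠ ∞ := hΩb.measure_lt_top.ne
  have hv0 : 0 < (volume Ω).toReal := ENNReal.toReal_pos (hΩ.measure_pos volume hΩn).ne' hvt
  -- Half of the admissible volume is spent on approximating `Ω` by a compact set, half on the gaps.
  set target : ℝ := ε / 2 * (volume Ω).toReal with htarget
  have htpos : 0 < target := by positivity
  obtain ⟨V, hV0, hV⟩ := exists_volume_inter_distInt_le hΩb
  -- the relative gap widths
  set Z : ℝ := ∑' n : ℕ, 1 / ((n : ℝ) + 1) ^ (2 : ℝ) with hZ
  have hZ0 : 0 < Z := summable_one_div_add_one_rpow.tsum_pos (fun n => by positivity) 0 (by simp)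
  set c : ℝ := min 1 (target / (V * Z)) with hc
  have hc0 : 0 < c := lt_min one_pos (by positivity)
  have hc1 : c ≤ 1 := min_le_left _ _
  set δ : ℕ → ℝ := gapWidth c τ with hδ
  have hδ0 : ∀ n, 0 < δ n := gapWidth_pos hc0 τ
  have hδ1 : ∀ n, δ n ≤ 1 := fun n => (gapWidth_le_self hc0 hτ n).trans hc1
  -- the compact set of admissible cells
  obtain ⟨H, hHΩ, hHc, hHv⟩ := hΩ.measurableSet.exists_isCompact_sdiff_lt hvt
    (ε := ENNReal.ofReal target) (by simpa using htpos)
  obtain ⟨ρ, hρ0, hρ⟩ := hHc.exists_cthickening_subset_open hΩ hHΩ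
  set S := Metric.cthickening ρ H with hS
  have hSc : IsCompact S := hHc.cthickening
  obtain ⟨L, M, hL, hM, hFM, hFL⟩ := exists_bounds_of_locallyLipschitzOn (η := η) hF hSc hρ
  -- the mesh
  set r₀ : ℝ := min 1 (min (ρ / (k + 1)) (η / (4 * M * k + 1))) with hr₀
  have hr₀0 : 0 < r₀ := lt_min one_pos (lt_min (by positivity) (by positivity))
  have hr₀1 : r₀ ≤ 1 := min_le_left _ _
  -- Cells have diameter at most `k * r₀`, so those meeting `H` stay inside the thickening `S`,
  -- where `F` is controlled.
  have hr₀ρ : k * r₀ ≤ ρ := by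
    have : r₀ ≤ ρ / (k + 1) := (min_le_right _ _).trans (min_le_left _ _)
    rw [le_div_iff₀ (by positivity)] at this
    nlinarith
  have hr₀η : 4 * M * k * r₀ ≤ η := by
    have : r₀ ≤ η / (4 * M * k + 1) := (min_le_right _ _).trans (min_le_right _ _)
    rw [le_div_iff₀ (by positivity)] at this
    nlinarith
  set r : ℕ → ℝ := fun n => r₀ / 2 ^ n with hr
  have hrpos : ∀ n, 0 < r n := fun n => by simp only [hr]; positivity
  have hr1 : ∀ n, r n ≤ 1 := fun n => by
    simp only [hr]
    exact div_le_one_of_le₀ (hr₀1.trans (one_le_pow₀ one_le_two)) (by positivity)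
  have hr0 : r 0 = r₀ := by simp [hr]
  have hrs : ∀ n, r (n + 1) = r n / 2 := fun n => by simp only [hr, pow_succ]; field_simp
  set E : Set (Euc k) := {y | ∃ x ∈ H, SameCell (r 0) x y} with hE
  have hHE : H ⊆ E := fun x hx => ⟨x, hx, SameCell.refl _ _⟩
  have hEs : ∀ x ∈ E, ∀ y, SameCell (r 0) x y → y ∈ E := fun x ⟨z, hz, hzx⟩ y hxy =>
    ⟨z, hz, hzx.trans hxy⟩
  have hES : E ⊆ S := fun y ⟨x, hx, hxy⟩ => by
    refine Metric.mem_cthickening_of_dist_le y x ρ H hx ?_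
    rw [dist_eq_norm]
    exact (hxy.symm.norm_sub_le (hrpos 0)).trans (by rw [hr0]; exact hr₀ρ)
  -- the corrections
  obtain ⟨Λ, hΛ1, hΛ⟩ := exists_grid_cutoff k
  choose Φ Φ' hΦ hΦ1 hΦ0 using fun n => hΛ (r n) (δ n) (hrpos n) (hδ0 n) (hδ1 n)
  have hΛ0 : 0 ≤ Λ := zero_le_one.trans hΛ1
  set core : ℕ → Set (Euc k) := fun n => gridCore k (r n) (δ n) with hcore
  obtain ⟨A, b, C, hC, hA, hb, ha, hD, hAE, hw, hsol⟩ := exists_cell_corrections (core := core)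
    (r := r) (Φ := Φ) (E := E) hL hM (fun x hx => hFM x (hES hx))
    (fun x hx y hy => hFL x (hES hx) y (hES hy)) hEs (hrpos 0) hrs (by rw [hr0]; exact hr₀η)
    (fun n => (hΦ n).abs_le_one) (fun n x hx => (hΦ1 n x hx).1)
  set Q : ℝ := 2 * levelConst k Λ C with hQ
  have hCQ' : 2 * C ≤ levelConst k Λ C := two_mul_le_levelConst hΛ0 hC
  have hQ0 : 0 ≤ levelConst k Λ C := by linarith
  have hCQ : 2 * C ≤ Q := by linarith
  set w : ℕ → Euc k → Euc m := fun n => cellBump (Φ n) (A n) (b n) with hwdef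
  set f : ℕ → Euc k → Euc k →L[ℝ] Euc m := fun n => cellBumpDeriv (Φ n) (Φ' n) (A n) (b n) with hf
  set K : Set (Euc k) := E ∩ ⋂ n, core n with hK
  have hKE : K ⊆ E := inter_subset_left
  have hKcore : ∀ x ∈ K, ∀ n, x ∈ core n := fun x hx n => mem_iInter.1 hx.2 n
  have hwη : ∀ n x, ‖w n x‖ ≤ η / 2 * (1 / 2) ^ n := fun n x => by
    refine (hw n x).trans ?_
    have e : 2 * M * k * r n = 4 * M * k * r₀ / 2 * (1 / 2) ^ n := by
      simp only [hr, one_div, inv_pow]; field_simp; ring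
    rw [e]; gcongr
  have hfA : ∀ n, ∀ x ∈ core n, f n x = A n x := fun n x hx =>
    cellBumpDeriv_of_mem_core (hΦ1 n) hx
  have hgeo : Summable fun n : ℕ => η / 2 * (1 / 2 : ℝ) ^ n := summable_geometric_two.mul_left _
  have hgeo1 : ∑' n : ℕ, η / 2 * (1 / 2 : ℝ) ^ n = η := by
    rw [tsum_mul_left, tsum_geometric_two]; ring
  have hrsum : Summable r := by
    refine (summable_geometric_two.mul_left r₀).congr fun n => ?_
    simp only [hr, one_div, inv_pow]; rfl
  have hgapv : ∀ n, volume ((core n)ᶜ ∩ Ω) ≤ ENNReal.ofReal (V * δ n) := fun n => by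
    refine (measure_mono (inter_subset_inter_left _ (compl_gridCore_subset k (r n) (δ n)))).trans ?_
    simpa using hV (r n) 0 (δ n) (hrpos n) (hr1 n) (hδ0 n).le
  have hKclosed : IsClosed K := by
    -- Intersecting with the core of level zero once more changes nothing, but makes the saturated
    -- set `E` closed within it.
    have e : K = (E ∩ core 0) ∩ ⋂ n, core n := by
      ext x; constructor
      · exact fun hx => ⟨⟨hx.1, hKcore x hx 0⟩, hx.2⟩
      · exact fun hx => ⟨hx.1.1, hx.2⟩
    rw [e]
    exact (isClosed_saturation_inter_gridCore (hrpos 0) (hδ0 0) hEs).inter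
      (isClosed_iInter fun n => isClosed_gridCore k _ _)
  refine ⟨c, r₀, Q, V, K, S, w, f, ?_, ?_⟩
  · refine
      { c_pos := hc0
        c_le := hc1
        tau_nonneg := hτ
        mesh_pos := hr₀0
        mesh_le := hr₀1
        Q_nonneg := by positivity
        isCompact := hSc
        subset := hρ
        hasFDerivAt := fun n x => hasFDerivAt_cellBump (hΦ n) (hΦ0 n) (hA n) (hb n) x
        eq_zero := fun n x hx => ?_
        norm_le := hwη
        norm_deriv_le := fun n x => ?_
        norm_deriv_sub_le := fun θ hθ0 hθ1 n x y => norm_level_sub_le_rpow (hrpos n) (hδ0 n) (hδ1 n)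
          hΛ0 hC (hΦ n) (hΦ0 n) (hA n) (hb n) (ha n) (hD n) hθ0 hθ1 x y
        norm_deriv_core_le := fun n x hx => ?_
        norm_deriv_core_sub_le := fun θ hθ0 n x hx y hy => ?_
        isCompact_K := hSc.of_isClosed_subset hKclosed (hKE.trans hES)
        K_subset := hKE.trans (hES.trans hρ)
        hasSum_deriv := fun x hx => ?_
        separated := ⟨δ 0 * r 0, mul_pos (hδ0 0) (hrpos 0), fun x hx y hy => ?_⟩
        volume_gap_le := hgapv
        volume_layer_le := fun n l => ?_ }
    · have : A n x = 0 := by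
        by_contra h
        exact hx (hES (hAE n x h))
      simp [hwdef, cellBump, this]
    · refine (norm_level_le (hrpos n) (hδ0 n) (hδ1 n) hΛ0 hC (hΦ n) (ha n) (hD n) x).trans ?_
      have := hrpos n
      have := hδ0 n
      gcongr
      linarith
    · rw [hfA n x hx]
      refine (ha n x).trans ?_
      have := (hrpos n).le
      gcongr
      linarith
    · refine (norm_core_sub_le_rpow (hrpos n) (hδ0 n) hC (hΦ1 n) (hA n) (ha n) hθ0 hx hy).trans ?_
      have := hrpos n
      have := hδ0 n
      gcongr
    · have hAx : ∀ n, f n x = A n x := fun n => hfA n x (hKcore x hx n)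
      simp_rw [hAx]
      have hsA : Summable fun n => A n x :=
        Summable.of_norm_bounded (hrsum.mul_left C) fun n => ha n x
      have hsw : Summable fun n => w n x := Summable.of_norm_bounded hgeo fun n => hwη n x
      have ht := hsw.hasSum.tendsto_sum_nat
      have hxΩ : x ∈ Ω := hρ (hES (hKE hx))
      have hFc : ContinuousAt (fun p => F (x, p)) (∑' n, w n x) := by
        have h1 : ContinuousOn (fun p : Euc m => F (x, p)) univ :=
          hF.continuousOn.comp (by fun_prop) fun p _ => ⟨hxΩ, mem_univ p⟩
        exact (continuousOn_univ.1 h1).continuousAt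
      have hF1 := hFc.tendsto.comp ht
      -- The defect at stage `n` is at most `C * r n`; in the limit, continuity of `F` in its second
      -- variable yields the equation.
      have hz : Filter.Tendsto (fun n => ∑ j ∈ Finset.range n, A j x -
          F (x, ∑ j ∈ Finset.range n, w j x)) Filter.atTop (nhds 0) := by
        refine squeeze_zero_norm (fun n => hsol n x ⟨hKE hx, fun j _ => hKcore x hx j⟩) ?_
        simpa using hrsum.tendsto_atTop_zero.const_mul C
      have hlim := hz.add hF1
      simp only [Function.comp_def, sub_add_cancel, zero_add] at hlim
      have hu := tendsto_nhds_unique hsA.hasSum.tendsto_sum_nat hlim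
      rw [← hu]
      exact hsA.hasSum
    -- A point outside `K` either leaves `E`, hence the coarsest cell of `x`, or falls into some gap
    -- that `x` avoids.
    · by_cases hyE : y ∈ E
      · right
        by_contra! hcon
        exact hy ⟨hyE, mem_iInter.2 fun n => hcon n (hKcore x hx n)⟩
      · left
        exact le_norm_sub_of_not_sameCell (hrpos 0) (hKcore x hx 0) fun h =>
          hyE (hEs x (hKE hx) y h)
    · refine (hV (r n) _ _ (hrpos n) (hr1 n) ?_).trans (le_of_eq ?_)
      · have := (hδ0 n).le
        have h2 : ((1 : ℝ) / 2) ^ (l + 1) ≤ (1 / 2) ^ l :=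
          pow_le_pow_of_le_one (by norm_num) (by norm_num) (Nat.le_succ l)
        gcongr
      · congr 1
        rw [pow_succ]; ring
  · have hsub : Ω \ K ⊆ (Ω \ H) ∪ ⋃ n, ((core n)ᶜ ∩ Ω) := by
      rintro x ⟨hxΩ, hxK⟩
      by_cases hxH : x ∈ H
      · right
        by_contra hcon
        simp only [mem_iUnion, mem_inter_iff, mem_compl_iff, not_exists, not_and] at hcon
        refine hxK ⟨hHE hxH, mem_iInter.2 fun n => ?_⟩
        by_contra hn
        exact hcon n hn hxΩ
      · exact Or.inl ⟨hxΩ, hxH⟩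
    have hsumδ : Summable fun n : ℕ => V * (c * (1 / ((n : ℝ) + 1) ^ (2 : ℝ))) :=
      (summable_one_div_add_one_rpow.mul_left c).mul_left V
    have hle : ∑' n : ℕ, V * (c * (1 / ((n : ℝ) + 1) ^ (2 : ℝ))) ≤ target := by
      rw [tsum_mul_left, tsum_mul_left, ← hZ]
      have : c ≤ target / (V * Z) := min_le_right _ _
      rw [le_div_iff₀ (by positivity)] at this
      linarith
    calc volume (Ω \ K) ≤ volume (Ω \ H) + ∑' n, volume ((core n)ᶜ ∩ Ω) :=
          (measure_mono hsub).trans ((measure_union_le _ _).trans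
            (by gcongr; exact measure_iUnion_le _))
      _ ≤ ENNReal.ofReal target +
          ∑' n : ℕ, ENNReal.ofReal (V * (c * (1 / ((n : ℝ) + 1) ^ (2 : ℝ)))) := by
          refine add_le_add hHv.le (ENNReal.tsum_le_tsum fun n => ?_)
          refine (hgapv n).trans (ENNReal.ofReal_le_ofReal ?_)
          gcongr
          exact gapWidth_le hc0 hτ n
      _ ≤ ENNReal.ofReal target + ENNReal.ofReal target := by
          rw [← ENNReal.ofReal_tsum_of_nonneg (fun n => by positivity) hsumδ]
          gcongr
      _ = ENNReal.ofReal ε * volume Ω := by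
          calc _ = ENNReal.ofReal (ε * (volume Ω).toReal) := by
                rw [← ENNReal.ofReal_add htpos.le htpos.le, htarget]
                congr 1; ring
            _ = _ := by rw [ENNReal.ofReal_mul hε.le, ENNReal.ofReal_toReal hvt]

/-! ### Regularity of the sum -/

theorem enorm_tsum_le {G : Type*} [NormedAddCommGroup G] (g : ℕ → G) :
    ‖∑' n, g n‖ₑ ≤ ∑' n, ‖g n‖ₑ :=
  enorm_tsum_le_tsum_enorm

namespace IsCorrectionSeries

variable {k m : ℕ} {Ω : Set (Euc k)} {F : Euc k × Euc m → (Euc k →L[ℝ] Euc m)}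
  {η τ c r₀ Q V : ℝ} {K S : Set (Euc k)} {w : ℕ → Euc k → Euc m}
  {f : ℕ → Euc k → Euc k →L[ℝ] Euc m}

theorem mesh_pos' (h : IsCorrectionSeries Ω F η τ c r₀ Q V K S w f) (n : ℕ) : 0 < r₀ / 2 ^ n := by
  have := h.mesh_pos
  positivity

theorem mesh_le' (h : IsCorrectionSeries Ω F η τ c r₀ Q V K S w f) (n : ℕ) : r₀ / 2 ^ n ≤ 1 :=
  div_le_one_of_le₀ (h.mesh_le.trans (one_le_pow₀ one_le_two)) (by positivity)

theorem gap_pos (h : IsCorrectionSeries Ω F η τ c r₀ Q V K S w f) (n : ℕ) : 0 < gapWidth c τ n :=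
  gapWidth_pos h.c_pos τ n

theorem gap_le (h : IsCorrectionSeries Ω F η τ c r₀ Q V K S w f) (n : ℕ) : gapWidth c τ n ≤ 1 :=
  (gapWidth_le_self h.c_pos h.tau_nonneg n).trans h.c_le

theorem eta_nonneg (h : IsCorrectionSeries Ω F η τ c r₀ Q V K S w f) : 0 ≤ η := by
  have := (norm_nonneg _).trans (h.norm_le 0 0)
  rw [pow_zero, mul_one] at this
  linarith

theorem summable_bound (η : ℝ) : Summable fun n : ℕ => η / 2 * (1 / 2 : ℝ) ^ n :=
  summable_geometric_two.mul_left _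

theorem hasSum (h : IsCorrectionSeries Ω F η τ c r₀ Q V K S w f) (x : Euc k) :
    HasSum (fun n => w n x) (∑' n, w n x) :=
  (Summable.of_norm_bounded (summable_bound η) fun n => h.norm_le n x).hasSum

theorem norm_tsum_le (h : IsCorrectionSeries Ω F η τ c r₀ Q V K S w f) (x : Euc k) :
    ‖∑' n, w n x‖ ≤ η := by
  refine tsum_of_norm_bounded (g := fun n => η / 2 * (1 / 2 : ℝ) ^ n) ?_ fun n => h.norm_le n x
  have := hasSum_geometric_two.mul_left (η / 2)
  simpa using this

theorem continuous_deriv (h : IsCorrectionSeries Ω F η τ c r₀ Q V K S w f) (n : ℕ) :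
    Continuous (f n) := by
  have := h.mesh_pos' n
  have := h.gap_pos n
  have := h.Q_nonneg
  refine LipschitzWith.continuous (K := ⟨Q * ((r₀ / 2 ^ n) ^ ((1 : ℝ) - 1) *
    gapWidth c τ n ^ (-(1 + 1 : ℝ))), by positivity⟩) (LipschitzWith.of_dist_le_mul fun x y => ?_)
  have h1 := h.norm_deriv_sub_le 1 zero_le_one le_rfl n x y
  rw [Real.rpow_one] at h1
  rw [dist_eq_norm, dist_eq_norm]
  exact h1

theorem continuous_term (h : IsCorrectionSeries Ω F η τ c r₀ Q V K S w f) (n : ℕ) :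
    Continuous (w n) :=
  continuous_iff_continuousAt.2 fun x => (h.hasFDerivAt n x).continuousAt

theorem continuous_tsum (h : IsCorrectionSeries Ω F η τ c r₀ Q V K S w f) :
    Continuous fun x => ∑' n, w n x :=
  _root_.continuous_tsum h.continuous_term (summable_bound η) h.norm_le

theorem tsupport_subset (h : IsCorrectionSeries Ω F η τ c r₀ Q V K S w f) :
    tsupport (fun x => ∑' n, w n x) ⊆ S := by
  refine closure_minimal (fun x hx => ?_) h.isCompact.isClosed
  by_contra hxS
  refine hx ?_
  simp [h.eq_zero _ x hxS]

theorem hasCompactSupport_term (h : IsCorrectionSeries Ω F η τ c r₀ Q V K S w f) (n : ℕ) :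
    HasCompactSupport (w n) :=
  HasCompactSupport.intro h.isCompact fun x hx => h.eq_zero n x hx

/-- Geometric decay of the corrections, in the norms weighted by the exponent `ι = 1 / q`. -/
theorem exists_decay (h : IsCorrectionSeries Ω F η τ c r₀ Q V K S w f) {θ ι : ℝ} (hθ0 : 0 ≤ θ)
    (hθ1 : θ ≤ 1) (hι1 : ι ≤ 1) (hτ : τ * (1 + θ - ι) < 1 - θ) :
    ∃ B ρ : ℝ, 0 ≤ B ∧ 0 < ρ ∧ ρ < 1 ∧
      (∀ n x, ‖f n x‖ * gapWidth c τ n ^ ι ≤ B * ρ ^ n * ρ ^ n) ∧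
      (∀ n, ∀ x, x ∉ (gridCore k (r₀ / 2 ^ n) (gapWidth c τ n))ᶜ →
        ‖f n x‖ ≤ B * ρ ^ n * ρ ^ n) ∧
      (∀ n x y, ‖f n x - f n y‖ * gapWidth c τ n ^ ι ≤ B * ρ ^ n * ρ ^ n * ‖x - y‖ ^ θ) ∧
      ∀ n x y, x ∉ (gridCore k (r₀ / 2 ^ n) (gapWidth c τ n))ᶜ →
        y ∉ (gridCore k (r₀ / 2 ^ n) (gapWidth c τ n))ᶜ →
        ‖f n x - f n y‖ ≤ B * ρ ^ n * ρ ^ n * ‖x - y‖ ^ θ := by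
  obtain ⟨B, ρ, hB, hρ0, hρ1, hT⟩ := exists_rpow_mul_gapWidth_rpow_le h.mesh_pos h.c_pos hτ
  -- All four bounds are dominated by this one quantity, because mesh and gap width are at most one
  -- and lowering their exponents only increases the powers.
  have hT' : ∀ n, Q * ((r₀ / 2 ^ n) ^ (1 - θ) * gapWidth c τ n ^ (-(1 + θ - ι))) ≤
      Q * B * ρ ^ n * ρ ^ n := fun n => by
    have := mul_le_mul_of_nonneg_left (hT n) h.Q_nonneg
    linarith
  refine ⟨Q * B, ρ, mul_nonneg h.Q_nonneg hB, hρ0, hρ1, fun n x => ?_, fun n x hx => ?_,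
    fun n x y => ?_, fun n x y hx hy => ?_⟩
  all_goals
    have hr := h.mesh_pos' n
    have hr1 := h.mesh_le' n
    have hδ := h.gap_pos n
    have hδ1 := h.gap_le n
    have hQ := h.Q_nonneg
    have hTn := hT' n
    set r := r₀ / 2 ^ n
    set δ := gapWidth c τ n
  · refine le_trans ?_ hTn
    calc ‖f n x‖ * δ ^ ι ≤ Q * (r / δ) * δ ^ ι := by gcongr; exact h.norm_deriv_le n x
      _ = Q * (r ^ (1 : ℝ) * δ ^ (-(1 - ι))) := by
        rw [Real.rpow_one, neg_sub, Real.rpow_sub hδ, Real.rpow_one]; ring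
      _ ≤ _ := by
        gcongr Q * (?_ * ?_)
        · exact Real.rpow_le_rpow_of_exponent_ge hr hr1 (by linarith)
        · exact Real.rpow_le_rpow_of_exponent_ge hδ hδ1 (by linarith)
  · refine le_trans ?_ hTn
    rw [notMem_compl_iff] at hx
    calc ‖f n x‖ ≤ Q * (r ^ (1 : ℝ) * δ ^ (0 : ℝ)) := by
          rw [Real.rpow_one, Real.rpow_zero, mul_one]; exact h.norm_deriv_core_le n x hx
      _ ≤ _ := by
        gcongr Q * (?_ * ?_)
        · exact Real.rpow_le_rpow_of_exponent_ge hr hr1 (by linarith)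
        · exact Real.rpow_le_rpow_of_exponent_ge hδ hδ1 (by linarith)
  · calc ‖f n x - f n y‖ * δ ^ ι ≤ Q * (r ^ (1 - θ) * δ ^ (-(1 + θ))) * ‖x - y‖ ^ θ * δ ^ ι := by
          gcongr; exact h.norm_deriv_sub_le θ hθ0 hθ1 n x y
      _ = Q * (r ^ (1 - θ) * δ ^ (-(1 + θ - ι))) * ‖x - y‖ ^ θ := by
          rw [show -(1 + θ - ι) = -(1 + θ) + ι by ring, Real.rpow_add hδ]; ring
      _ ≤ _ := by gcongr
  · rw [notMem_compl_iff] at hx hy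
    calc ‖f n x - f n y‖ ≤ Q * (r ^ (1 - θ) * δ ^ (-θ)) * ‖x - y‖ ^ θ :=
          h.norm_deriv_core_sub_le θ hθ0 n x hx y hy
      _ ≤ Q * (r ^ (1 - θ) * δ ^ (-(1 + θ - ι))) * ‖x - y‖ ^ θ := by
          gcongr Q * (_ * ?_) * _
          exact Real.rpow_le_rpow_of_exponent_ge hδ hδ1 (by linarith)
      _ ≤ _ := by gcongr

theorem measurableSet_gap (k : ℕ) (r δ : ℝ) : MeasurableSet (gridCore k r δ)ᶜ :=
  (isClosed_gridCore k r δ).measurableSet.compl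

theorem lintegral_rpow_lt_top (h : IsCorrectionSeries Ω F η τ c r₀ Q V K S w f)
    (hΩb : Bornology.IsBounded Ω) {θ p : ℝ} (hθ0 : 0 ≤ θ) (hθ1 : θ ≤ 1) (hp : 1 ≤ p)
    (hτ : τ * (1 + θ - 1 / p) < 1 - θ) :
    ∫⁻ x in Ω, (∑' n, ‖f n x‖ₑ) ^ p < ∞ := by
  have hp0 : 0 < p := one_pos.trans_le hp
  obtain ⟨B, ρ, hB, hρ0, hρ1, h1, h2, -, -⟩ := h.exists_decay hθ0 hθ1
    (div_le_one_of_le₀ hp hp0.le) hτ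
  exact lintegral_tsum_enorm_rpow_lt_top hp0 hρ0 hρ1 hB hΩb.measure_lt_top h.gap_pos
    (fun n => measurableSet_gap _ _ _) h.volume_gap_le h1 h2

/-- The exponent condition is weakest for `p = 1`, so it follows from the one for any `ι ≤ 1`. The
finite integral gives almost everywhere summability and the exchange of sum and integral. -/
theorem lintegral_lt_top (h : IsCorrectionSeries Ω F η τ c r₀ Q V K S w f)
    (hΩb : Bornology.IsBounded Ω) {θ ι : ℝ} (hθ0 : 0 ≤ θ) (hθ1 : θ ≤ 1) (hι : ι ≤ 1)
    (hτ : τ * (1 + θ - ι) < 1 - θ) :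
    ∫⁻ x in Ω, ∑' n, ‖f n x‖ₑ < ∞ := by
  have := h.lintegral_rpow_lt_top hΩb hθ0 hθ1 le_rfl (lt_of_le_of_lt
    (mul_le_mul_of_nonneg_left (by linarith) h.tau_nonneg) hτ)
  simpa using this

theorem ae_hasSum_deriv (h : IsCorrectionSeries Ω F η τ c r₀ Q V K S w f)
    (hfin : ∫⁻ x in Ω, ∑' n, ‖f n x‖ₑ < ∞) :
    ∀ᵐ x ∂(volume.restrict Ω), HasSum (fun n => f n x) (∑' n, f n x) := by
  have hm : Measurable fun x => ∑' n, ‖f n x‖ₑ :=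
    Measurable.tsum fun n => (h.continuous_deriv n).enorm.measurable
  filter_upwards [ae_lt_top hm hfin.ne] with x hx
  exact (Summable.of_enorm hx.ne).hasSum

theorem aestronglyMeasurable_tsum_deriv (h : IsCorrectionSeries Ω F η τ c r₀ Q V K S w f)
    (hfin : ∫⁻ x in Ω, ∑' n, ‖f n x‖ₑ < ∞) :
    AEStronglyMeasurable (fun x => ∑' n, f n x) (volume.restrict Ω) := by
  refine aestronglyMeasurable_of_tendsto_ae Filter.atTop
    (f := fun N x => ∑ n ∈ Finset.range N, f n x) (fun N => ?_) ?_
  · exact (continuous_finsetSum _ fun n _ => h.continuous_deriv n).aestronglyMeasurable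
  · filter_upwards [h.ae_hasSum_deriv hfin] with x hx
    exact hx.tendsto_sum_nat

theorem memLp_tsum_deriv (h : IsCorrectionSeries Ω F η τ c r₀ Q V K S w f)
    (hfin : ∫⁻ x in Ω, ∑' n, ‖f n x‖ₑ < ∞)
    (hΩb : Bornology.IsBounded Ω) {θ : ℝ} {q : ℝ≥0∞} (hq : 1 ≤ q) (hθ0 : 0 ≤ θ) (hθ1 : θ ≤ 1)
    (hτ : τ * (1 + θ - (q⁻¹).toReal) < 1 - θ) :
    MemLp (fun x => ∑' n, f n x) q (volume.restrict Ω) := by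
  refine ⟨h.aestronglyMeasurable_tsum_deriv hfin, ?_⟩
  rcases eq_or_ne q ∞ with rfl | hqt
  · obtain ⟨B, ρ, hB, hρ0, hρ1, h1, -, -, -⟩ := h.exists_decay (ι := 0) hθ0 hθ1 zero_le_one
      (by simpa using hτ)
    have hs : Summable fun n : ℕ => B * ρ ^ n * ρ ^ n := by
      refine ((summable_geometric_of_lt_one (r := ρ * ρ) (by positivity)
        (by nlinarith)).mul_left B).congr fun n => ?_
      rw [mul_pow]; ring
    rw [eLpNorm_exponent_top]
    exact eLpNormEssSup_lt_top_of_ae_bound (C := ∑' n : ℕ, B * ρ ^ n * ρ ^ n)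
      (Filter.Eventually.of_forall fun x =>
        tsum_of_norm_bounded hs.hasSum fun n => by simpa using h1 n x)
  · have hq0 : q ≠ 0 := (zero_lt_one.trans_le hq).ne'
    have hp : 1 ≤ q.toReal := by
      rw [← ENNReal.toReal_one]; exact ENNReal.toReal_mono hqt hq
    rw [eLpNorm_lt_top_iff_lintegral_rpow_enorm_lt_top hq0 hqt]
    refine lt_of_le_of_lt (lintegral_mono fun x => ?_)
      (h.lintegral_rpow_lt_top hΩb (p := q.toReal) hθ0 hθ1 hp (by
        rw [one_div, ← ENNReal.toReal_inv]; exact hτ))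
    gcongr
    exact enorm_tsum_le _

/-- The derivative of the series is Hölder continuous when the gaps are wide enough. -/
theorem exists_holder_tsum_deriv (h : IsCorrectionSeries Ω F η τ c r₀ Q V K S w f) {θ : ℝ}
    (hθ0 : 0 ≤ θ) (hθ1 : θ ≤ 1) (hτ : τ * (1 + θ) < 1 - θ) :
    ∃ C : ℝ≥0, HolderOnWith C θ.toNNReal (fun x => ∑' n, f n x) Ω ∧
      ∀ x, ‖∑' n, f n x‖ ≤ C ∧ HasSum (fun n => f n x) (∑' n, f n x) := by
  obtain ⟨B, ρ, hB, hρ0, hρ1, h1, -, h3, -⟩ := h.exists_decay (ι := 0) hθ0 hθ1 zero_le_one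
    (by simpa using hτ)
  have hs : Summable fun n : ℕ => B * ρ ^ n * ρ ^ n := by
    refine ((summable_geometric_of_lt_one (r := ρ * ρ) (by positivity)
      (by nlinarith)).mul_left B).congr fun n => ?_
    rw [mul_pow]; ring
  have hsum : ∀ x, HasSum (fun n => f n x) (∑' n, f n x) := fun x =>
    (Summable.of_norm_bounded hs fun n => by simpa using h1 n x).hasSum
  obtain ⟨C, hC⟩ : ∃ C : ℝ≥0, (C : ℝ) = ∑' n : ℕ, B * ρ ^ n * ρ ^ n :=
    ⟨⟨_, tsum_nonneg fun n => by positivity⟩, rfl⟩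
  refine ⟨C, ?_, fun x => ⟨hC ▸ tsum_of_norm_bounded hs.hasSum fun n => by simpa using h1 n x, hsum x⟩⟩
  intro x _ y _
  have hxy : ‖(∑' n, f n x) - ∑' n, f n y‖ ≤ C * ‖x - y‖ ^ θ := by
    rw [hC, ← ((hsum x).sub (hsum y)).tsum_eq]
    exact tsum_of_norm_bounded (hs.hasSum.mul_right _) fun n => by simpa using h3 n x y
  rw [edist_eq_enorm_sub, edist_eq_enorm_sub, ← ofReal_norm, ← ofReal_norm, Real.coe_toNNReal _ hθ0,
    ENNReal.ofReal_rpow_of_nonneg (norm_nonneg _) hθ0, ← ENNReal.ofReal_coe_nnreal,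
    ← ENNReal.ofReal_mul (NNReal.coe_nonneg _)]
  exact ENNReal.ofReal_le_ofReal hxy

/-- For finite `q` this is the Gagliardo estimate with a margin `α < θ`. For `q = ∞` the reciprocal
is zero, the gap volume gives no gain, and the same condition yields Hölder continuity everywhere.
-/
theorem memFracSobolev_tsum_deriv (h : IsCorrectionSeries Ω F η τ c r₀ Q V K S w f)
    (hfin : ∫⁻ x in Ω, ∑' n, ‖f n x‖ₑ < ∞) (hΩ : MeasurableSet Ω)
    (hΩb : Bornology.IsBounded Ω) {α θ : ℝ} {q : ℝ≥0∞} (hq : 1 ≤ q) (hα0 : 0 ≤ α) (hαθ : α < θ)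
    (hθ1 : θ ≤ 1) (hτ : τ * (1 + θ - (q⁻¹).toReal) < 1 - θ) :
    MemFracSobolev α q Ω (fun x => ∑' n, f n x) := by
  have hθ0 : 0 ≤ θ := hα0.trans hαθ.le
  refine ⟨h.memLp_tsum_deriv hfin hΩb hq hθ0 hθ1 hτ, fun _ hqt => ?_, fun hα hqt => ?_⟩
  · have hp : 1 ≤ q.toReal := by
      rw [← ENNReal.toReal_one]; exact ENNReal.toReal_mono hqt hq
    have hp0 : 0 < q.toReal := one_pos.trans_le hp
    obtain ⟨B, ρ, hB, hρ0, hρ1, -, -, h3, h4⟩ := h.exists_decay (ι := 1 / q.toReal) hθ0 hθ1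
      (div_le_one_of_le₀ hp hp0.le) (by rw [one_div, ← ENNReal.toReal_inv]; exact hτ)
    exact gagliardoEnergy_tsum_lt_top hp0 hρ0 hρ1 hB hαθ hΩ hΩb h.gap_pos
      (fun n => measurableSet_gap _ _ _) h.volume_gap_le h3 h4 (h.ae_hasSum_deriv hfin) hθ0
  · subst hqt
    have hτ' : τ * (1 + θ) < 1 - θ := by simpa using hτ
    obtain ⟨C, hC, -⟩ := h.exists_holder_tsum_deriv (θ := α) hα0 (hαθ.le.trans hθ1) (by
      have := mul_le_mul_of_nonneg_left (show 1 + α ≤ 1 + θ by linarith) h.tau_nonneg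
      linarith)
    exact ⟨_, Filter.EventuallyEq.rfl, C, hC⟩

/-- The indicator of `K` has finite fractional perimeter. -/
theorem memFracSobolev_indicator (h : IsCorrectionSeries Ω F η τ c r₀ Q V K S w f)
    (hΩ : MeasurableSet Ω) (hΩb : Bornology.IsBounded Ω) {s θ : ℝ}
    (hs : 0 < s → s < θ ∧ θ < 1 ∧ θ < τ * (1 - θ)) :
    MemFracSobolev s 1 Ω (K.indicator fun _ => (1 : ℝ)) := by
  have hfin : IsFiniteMeasure (volume.restrict Ω) := ⟨by
    rw [Measure.restrict_apply_univ]; exact hΩb.measure_lt_top⟩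
  refine ⟨(memLp_const (1 : ℝ)).indicator h.isCompact_K.measurableSet, fun hs0 _ => ?_,
    fun _ h' => absurd h' ENNReal.one_ne_top⟩
  obtain ⟨h1, h2, h3⟩ := hs hs0
  obtain ⟨d, hd, hK⟩ := h.separated
  rw [ENNReal.toReal_one]
  refine gagliardoEnergy_indicator_lt_top (r := fun n => r₀ / 2 ^ n) (δ := gapWidth c τ) hΩ hΩb h1
    (hs0.trans h1).le h2 h.mesh_pos' h.gap_pos hd h.volume_layer_le ?_ hK
  refine (summable_rpow_mul_gapWidth_rpow (τ := τ) (a := -θ) (b := -(1 - θ)) h.mesh_pos h.c_pos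
    (by linarith)).congr fun n => ?_
  rw [neg_neg, mul_comm]

theorem integral_smul_term_eq (h : IsCorrectionSeries Ω F η τ c r₀ Q V K S w f) {φ : Euc k → ℝ}
    (hφ : ContDiff ℝ ((⊤ : ℕ∞) : WithTop ℕ∞) φ) (hφc : HasCompactSupport φ) (hφΩ : tsupport φ ⊆ Ω)
    (v : Euc k) (n : ℕ) :
    ∫ x in Ω, (fderiv ℝ φ x v) • w n x = -∫ x in Ω, φ x • f n x v := by
  have hd : ∀ x, fderiv ℝ (w n) x = f n x := fun x => (h.hasFDerivAt n x).fderiv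
  have hφd : Continuous (fderiv ℝ φ) := hφ.continuous_fderiv (by simp)
  have hφd' : Continuous fun x => fderiv ℝ φ x v := hφd.clm_apply continuous_const
  have hfv : Continuous fun x => f n x v := (h.continuous_deriv n).clm_apply continuous_const
  have z0 : ∀ x, x ∉ Ω → φ x = 0 := fun x hx => image_eq_zero_of_notMem_tsupport fun h => hx (hφΩ h)
  have z1 : ∀ x, x ∉ Ω → fderiv ℝ φ x v = 0 := fun x hx => by
    rw [fderiv_of_notMem_tsupport ℝ fun h => hx (hφΩ h)]; rfl
  rw [setIntegral_eq_integral_of_forall_compl_eq_zero fun x hx => by rw [z1 x hx, zero_smul],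
    setIntegral_eq_integral_of_forall_compl_eq_zero fun x hx => by rw [z0 x hx, zero_smul]]
  have := integral_smul_fderiv_eq_neg_fderiv_smul_of_integrable (μ := volume) (f := φ) (g := w n)
    (v := v)
    ((hφd'.smul (h.continuous_term n)).integrable_of_hasCompactSupport
      (h.hasCompactSupport_term n).smul_left)
    (by
      simp_rw [hd]
      exact (hφ.continuous.smul hfv).integrable_of_hasCompactSupport hφc.smul_right)
    ((hφ.continuous.smul (h.continuous_term n)).integrable_of_hasCompactSupport hφc.smul_right)
    (fun x _ => (hφ.differentiable (by simp)) x) (fun x _ => (h.hasFDerivAt n x).differentiableAt)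
  simp_rw [hd] at this
  rw [this, neg_neg]

/-- Each correction is `C¹`, so integration by parts holds termwise. The sums pass through the
integrals since the corrections decay geometrically in sup norm and their derivatives are summable
in `L¹`; no differentiability of the limit is required. -/
theorem isWeakGradient (h : IsCorrectionSeries Ω F η τ c r₀ Q V K S w f)
    (hΩb : Bornology.IsBounded Ω)
    (hfin : ∫⁻ x in Ω, ∑' n, ‖f n x‖ₑ < ∞) :
    IsWeakGradient Ω (fun x => ∑' n, w n x) (fun x => ∑' n, f n x) := by
  have hint : IntegrableOn (fun x => ∑' n, f n x) Ω volume :=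
    ⟨h.aestronglyMeasurable_tsum_deriv hfin,
      lt_of_le_of_lt (lintegral_mono fun x => enorm_tsum_le fun n => f n x) hfin⟩
  refine ⟨h.continuous_tsum.locallyIntegrable.locallyIntegrableOn _, hint.locallyIntegrableOn,
    fun φ hφ hφc hφΩ v => ?_⟩
  have hφd : Continuous (fderiv ℝ φ) := hφ.continuous_fderiv (by simp)
  have hφd' : Continuous fun x => fderiv ℝ φ x v := hφd.clm_apply continuous_const
  obtain ⟨M₀, hM₀⟩ := hφc.exists_bound_of_continuous hφ.continuous
  have hM₀0 : 0 ≤ M₀ := (norm_nonneg _).trans (hM₀ 0)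
  obtain ⟨M₁, hM₁⟩ := (hφc.fderiv_apply (𝕜 := ℝ) v).exists_bound_of_continuous hφd'
  have hM₁0 : 0 ≤ M₁ := (norm_nonneg _).trans (hM₁ 0)
  have hη := h.eta_nonneg
  have e1 : ∫ x in Ω, (fderiv ℝ φ x v) • ∑' n, w n x =
      ∑' n, ∫ x in Ω, (fderiv ℝ φ x v) • w n x := by
    rw [← integral_tsum]
    · exact integral_congr_ae (Filter.Eventually.of_forall fun x =>
        ((h.hasSum x).const_smul (fderiv ℝ φ x v)).tsum_eq.symm)
    · exact fun n => (hφd'.smul (h.continuous_term n)).aestronglyMeasurable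
    · refine (lt_of_le_of_lt (ENNReal.tsum_le_tsum (g := fun n : ℕ =>
        ENNReal.ofReal (M₁ * (η / 2 * (1 / 2) ^ n)) * volume Ω) fun n => ?_) ?_).ne
      · refine (lintegral_mono (g := fun _ => ENNReal.ofReal (M₁ * (η / 2 * (1 / 2) ^ n)))
          fun x => ?_).trans (by rw [setLIntegral_const])
        rw [← ofReal_norm]
        refine ENNReal.ofReal_le_ofReal ?_
        rw [norm_smul]
        exact mul_le_mul (hM₁ x) (h.norm_le n x) (norm_nonneg _) hM₁0
      · rw [ENNReal.tsum_mul_right]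
        exact ENNReal.mul_lt_top ((summable_bound η).mul_left M₁).tsum_ofReal_lt_top
          hΩb.measure_lt_top
  have e2 : ∫ x in Ω, φ x • (∑' n, f n x) v = ∑' n, ∫ x in Ω, φ x • f n x v := by
    rw [← integral_tsum]
    · refine integral_congr_ae ?_
      filter_upwards [h.ae_hasSum_deriv hfin] with x hx
      have hv : HasSum (fun n => f n x v) ((∑' n, f n x) v) :=
        hx.mapL (ContinuousLinearMap.apply ℝ (Euc m) v)
      exact (hv.const_smul (φ x)).tsum_eq.symm
    · exact fun n => (hφ.continuous.smul
        ((h.continuous_deriv n).clm_apply continuous_const)).aestronglyMeasurable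
    · refine (lt_of_le_of_lt (ENNReal.tsum_le_tsum (g := fun n : ℕ =>
        (ENNReal.ofReal M₀ * ‖v‖ₑ) * ∫⁻ x in Ω, ‖f n x‖ₑ) fun n => ?_) ?_).ne
      · rw [← lintegral_const_mul _ (h.continuous_deriv n).enorm.measurable]
        refine lintegral_mono fun x => ?_
        rw [enorm_smul]
        calc ‖φ x‖ₑ * ‖f n x v‖ₑ ≤ ENNReal.ofReal M₀ * (‖f n x‖ₑ * ‖v‖ₑ) := by
              gcongr
              · rw [← ofReal_norm]; exact ENNReal.ofReal_le_ofReal (hM₀ x)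
              · exact (f n x).le_opENorm v
          _ = _ := by ring
      · rw [ENNReal.tsum_mul_left, ← lintegral_tsum fun n =>
          (h.continuous_deriv n).enorm.aemeasurable]
        exact ENNReal.mul_lt_top (ENNReal.mul_lt_top ENNReal.ofReal_lt_top enorm_lt_top) hfin
  rw [e1, e2, ← tsum_neg]
  exact tsum_congr fun n => h.integral_smul_term_eq hφ hφc hφΩ v n

/-- The derivatives are bounded by a multiple of `r / δ`, which is summable when the gaps shrink
more slowly than the mesh, that is, `τ < 1`. -/
theorem hasFDerivAt_tsum (h : IsCorrectionSeries Ω F η τ c r₀ Q V K S w f) (hτ : τ < 1)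
    (x : Euc k) : HasFDerivAt (fun x => ∑' n, w n x) (∑' n, f n x) x ∧
      Continuous fun x => ∑' n, f n x := by
  have hs : Summable fun n : ℕ => Q * (r₀ / 2 ^ n / gapWidth c τ n) := by
    refine ((summable_rpow_mul_gapWidth_rpow (a := 1) (b := 1) h.mesh_pos h.c_pos
      (by linarith)).mul_left Q).congr fun n => ?_
    rw [Real.rpow_one, Real.rpow_neg_one, div_eq_mul_inv (r₀ / 2 ^ n)]
  exact ⟨_root_.hasFDerivAt_tsum hs h.hasFDerivAt h.norm_deriv_le (x₀ := x) (h.hasSum x).summable x,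
    _root_.continuous_tsum h.continuous_deriv hs h.norm_deriv_le⟩

end IsCorrectionSeries

/-! ### The theorem -/

theorem mainTheorem4 (k m : ℕ) (η ε : ℝ) (hη : 0 < η) (hε : 0 < ε)
    (q : ℝ≥0∞) (hq : 1 ≤ q) (α s : ℝ) (hα0 : 0 ≤ α) (hα1 : α < 1)
    (hs0 : 0 ≤ s) (hsq : s < 1 / (2 - (q⁻¹).toReal))
    (hαs : α < 1 - (2 - (q⁻¹).toReal) * s)
    (Ω : Set (Euc k)) (hΩ : IsOpen Ω) (hΩb : Bornology.IsBounded Ω)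
    (F : Euc k × Euc m → (Euc k →L[ℝ] Euc m))
    (hF : LocallyLipschitzOn (Ω ×ˢ (Set.univ : Set (Euc m))) F) :
    ∃ (K : Set (Euc k)) (u : Euc k → Euc m) (Du : Euc k → (Euc k →L[ℝ] Euc m)),
      IsCompact K ∧ K ⊆ Ω ∧
      IsWeakGradient Ω u Du ∧
      (tsupport u ⊆ Ω ∧ (∀ x, ‖u x‖ ≤ η) ∧
        ∀ᵐ x ∂(volume.restrict K), Du x = F (x, u x)) ∧
      (volume (Ω \ K) ≤ ENNReal.ofReal ε * volume Ω ∧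
        MemFracSobolev s 1 Ω (K.indicator fun _ => (1 : ℝ))) ∧
      (MemLp u ∞ (volume.restrict Ω) ∧ MemLp u q (volume.restrict Ω) ∧
        MemLp Du q (volume.restrict Ω) ∧ MemFracSobolev α q Ω Du) ∧
      (s < 1 / 2 →
        ContDiff ℝ 1 u ∧ HasCompactSupport u ∧ ∀ x ∈ K, fderiv ℝ u x = F (x, u x)) ∧
      (s = 0 → ∀ β : ℝ, 0 < β → β < 1 → MemC1Holder β Ω u) := by
  -- The construction needs positive volume, which sets the budget for the gaps.
  rcases Ω.eq_empty_or_nonempty with rfl | hΩn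
  · refine ⟨∅, fun _ => 0, fun _ => 0, isCompact_empty, Subset.rfl, ?_⟩
    have h0 : fderiv ℝ (fun _ : Euc k => (0 : Euc m)) = 0 := by ext; simp
    simp [IsWeakGradient, MemFracSobolev, gagliardoEnergy, MemC1Holder, tsupport, hη.le,
      HasCompactSupport, contDiff_const, Function.support_fun_zero]
    exact ⟨⟨fun x hx => absurd hx (notMem_empty x), fun x hx => absurd hx (notMem_empty x)⟩,
      fun _ _ => ⟨fun _ => 0, Filter.EventuallyEq.rfl⟩⟩
  have hι1 : (q⁻¹).toReal ≤ 1 := by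
    rw [← ENNReal.toReal_one]
    exact ENNReal.toReal_mono ENNReal.one_ne_top (ENNReal.inv_le_one.2 hq)
  obtain ⟨τ, θ, θ', hτ0, hαθ, hθ1, hτ, hτs, hθ', hτ1⟩ := exists_exponents hα1 hs0 hι1 hαs hα0
  obtain ⟨c, r₀, Q, V, K, S, w, f, h, hK⟩ := exists_isCorrectionSeries (k := k) (m := m) hη hε hτ0
    hΩ hΩb hΩn hF
  have hfin := h.lintegral_lt_top hΩb (hα0.trans hαθ.le) hθ1.le hι1 hτ
  have hfm : IsFiniteMeasure (volume.restrict Ω) := ⟨by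
    rw [Measure.restrict_apply_univ]; exact hΩb.measure_lt_top⟩
  have hutop : MemLp (fun x => ∑' n, w n x) ∞ (volume.restrict Ω) :=
    memLp_top_of_bound h.continuous_tsum.aestronglyMeasurable η
      (Filter.Eventually.of_forall h.norm_tsum_le)
  have hDu := h.memFracSobolev_tsum_deriv hfin hΩ.measurableSet hΩb hq hα0 hαθ hθ1.le hτ
  refine ⟨K, fun x => ∑' n, w n x, fun x => ∑' n, f n x, h.isCompact_K, h.K_subset,
    h.isWeakGradient hΩb hfin,
    ⟨h.tsupport_subset.trans h.subset, h.norm_tsum_le, ?_⟩,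
    ⟨hK, h.memFracSobolev_indicator hΩ.measurableSet hΩb hθ'⟩,
    ⟨hutop, hutop.mono_exponent le_top, hDu.1, hDu⟩, fun hs => ?_, fun hs β hβ0 hβ1 => ?_⟩
  · exact (ae_restrict_iff' h.isCompact_K.measurableSet).2
      (Filter.Eventually.of_forall fun x hx => (h.hasSum_deriv x hx).tsum_eq)
  · have hd := fun x => (h.hasFDerivAt_tsum (hτ1 hs) x).1
    have hdf : (fderiv ℝ fun x => ∑' n, w n x) = fun x => ∑' n, f n x :=
      funext fun x => (hd x).fderiv
    refine ⟨contDiff_one_iff_fderiv.2 ⟨fun x => (hd x).differentiableAt, ?_⟩,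
      h.isCompact.of_isClosed_subset (isClosed_tsupport _) h.tsupport_subset, fun x hx => ?_⟩
    · rw [hdf]; exact (h.hasFDerivAt_tsum (hτ1 hs) 0).2
    · rw [hdf]; exact (h.hasSum_deriv x hx).tsum_eq
  · have hτ1' := hτ1 (by rw [hs]; norm_num)
    have hd := fun x => (h.hasFDerivAt_tsum hτ1' x).1
    have hdf : (fderiv ℝ fun x => ∑' n, w n x) = fun x => ∑' n, f n x :=
      funext fun x => (hd x).fderiv
    -- For `s = 0` the exponent `τ` is zero, so the Hölder condition reduces to `0 < 1 - β`.
    obtain ⟨C, hC, hCb⟩ := h.exists_holder_tsum_deriv (θ := β) hβ0.le hβ1.le (by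
      rw [hτs hs]; linarith)
    refine ⟨(contDiff_one_iff_fderiv.2 ⟨fun x => (hd x).differentiableAt, ?_⟩).contDiffOn,
      ⟨η, fun x _ => h.norm_tsum_le x⟩, ⟨C, fun x _ => ?_⟩, C, ?_⟩
    · rw [hdf]; exact (h.hasFDerivAt_tsum hτ1' 0).2
    · rw [hdf]; exact (hCb x).1
    · rw [hdf]; exact hC
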